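/- Let $\mathcal A$ and $\mathcal B$ be abelian categories, each with enough projective objects and enough injective objects, and let $T:\mathcal A\to\mathcal B$ be a left exact additive functor. The comma category $(\mathcal B\downarrow T)$ has as objects the triples $\left(\begin{smallmatrix}A\\B\end{smallmatrix}\right)_\varphi$ with $A\in\mathcal A$, $B\in\mathcal B$ and $\varphi\in\mathrm{Hom}_{\mathcal B}(B,TA)$, and as morphisms the pairs $(\alpha,\beta)$ with $\varphi'\beta=T(\alpha)\varphi$; it is abelian. Let $\mathbf h(A,B)=\left(\begin{smallmatrix}A\\B\oplus TA\end{smallmatrix}\right)$, with the projection $B\oplus TA\to TA$ as structure morphism. For a class $\mathcal L$ of objects of an abelian category $\mathcal D$ put ${}^{\perp}\mathcal L=\{M\in\mathcal D\mid \mathrm{Ext}^1_{\mathcal D}(M,L)=0\text{ for all }L\in\mathcal L\}$. The class $\mathcal L$ is *special preenveloping* if for every object $M$ of $\mathcal D$ there is a monomorphism $g:M\to L$ with $L\in\mathcal L$ and $\operatorname{coker} g\in{}^{\perp}\mathcal L$. It is *closed under extensions* if for every short exact sequence $0\to L_1\to L_2\to L_3\to0$ with $L_1,L_3\in\mathcal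 L$ also $L_2\in\mathcal L$. For classes $\mathcal X$ of objects of $\mathcal A$ and $\mathcal Y$ of objects of $\mathcal B$, let $\langle\mathbf h(\mathcal X,\mathcal Y)\rangle$ be the smallest class of objects of $(\mathcal B\downarrow T)$ that contains all $\mathbf h(X,Y)$ with $X\in\mathcal X$, $Y\in\mathcal Y$ and is closed under extensions. The functor $T$ is *$\mathcal X$-exact* if for every short exact sequence $0\to X\to A_1\to A_2\to0$ in $\mathcal A$ with $X\in\mathcal X$ the sequence $0\to TX\to TA_1\to TA_2\to0$ is exact. A ($\mathbb Z$-indexed) complex $I$ of injective objects of $\mathcal D$ is *totally acyclic* if it is acyclic and $\mathrm{Hom}_{\mathcal D}(E,I)$ is acyclic for every injective object $E$. An object is *Gorenstein injective* if it is isomorphic to $Z_0(I)=\ker(I_0\to I_{-1})$ for some totally acyclic complex $I$ of injective objects; $\mathcal{GI}_{\mathcal D}$ is the class of these objects. The functor $T$ is *cocompatible* if $TE$ is acyclic for every acyclic complex $E$ of injective objects of $\mathcal A$, and $\mathrm{Hom}_{\mathcal B}(TI,J)$ is acyclic for every injective object $I$ of $\mathcal A$ and every totally acyclic complex $J$ of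 injective objects of $\mathcal B$. Then the following hold. (1) Let $\mathcal X$ and $\mathcal Y$ be classes of objects of $\mathcal A$ and $\mathcal B$ with $0\in\mathcal X$ and $0\in\mathcal Y$, and let $T$ be $\mathcal X$-exact. If $\mathcal X$ and $\mathcal Y$ are special preenveloping, then $\langle\mathbf h(\mathcal X,\mathcal Y)\rangle$ is special preenveloping in $(\mathcal B\downarrow T)$. Conversely, if $\langle\mathbf h(\mathcal X,\mathcal Y)\rangle$ is special preenveloping, $T({}^{\perp}\mathcal X\cap\mathcal X)\subseteq{}^{\perp}\mathcal Y$, and $\mathcal X$ and $\mathcal Y$ are closed under extensions, then $\mathcal X$ and $\mathcal Y$ are special preenveloping. (2) If $T$ is cocompatible, then $\mathcal{GI}_{\mathcal A}$ and $\mathcal{GI}_{\mathcal B}$ are special preenveloping in $\mathcal A$ and $\mathcal B$, respectively, if and only if $\mathcal{GI}_{(\mathcal B\downarrow T)}$ is special preenveloping in $(\mathcal B\downarrow T)$. -/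

import Mathlib

open CategoryTheory CategoryTheory.Limits

universe v u v₁ u₁ v₂ u₂

noncomputable section

namespace CommaPreenvelope

section General

variable {C : Type u} [Category.{v} C] [Abelian C]

/-- The left orthogonal class `⊥P`: the objects `M` with `Ext¹(M, X) = 0` for every `X` in `P`. -/
def leftPerp (P : ObjectProperty C) : ObjectProperty C := fun M =>
  letI := HasExt.standard C
  ∀ X : C, P X → Subsingleton (Abelian.Ext.{max u v} M X 1)

/-- `g : M ⟶ Y` is a special `P`-preenvelope of `M`. -/
structure IsSpecialPreenvelope (P : ObjectProperty C) {M Y : C} (g : M ⟶ Y) : Prop where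
  mono : Mono g
  mem : P Y
  cokernel_mem : leftPerp P (cokernel g)

/-- `P` is special preenveloping: every object has a special `P`-preenvelope. -/
def IsSpecialPreenveloping (P : ObjectProperty C) : Prop :=
  ∀ M : C, ∃ (Y : C) (g : M ⟶ Y), IsSpecialPreenvelope P g

/-- The extension closure of `P`: the smallest class of objects that contains `P` and is closed
under extensions. -/
inductive extensionClosure (P : ObjectProperty C) : ObjectProperty C
  | of (M : C) (hM : P M) : extensionClosure P M
  | ext (S : ShortComplex C) (hS : S.ShortExact) (h₁ : extensionClosure P S.X₁)
      (h₃ : extensionClosure P S.X₃) : extensionClosure P S.X₂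

/-- For an object `E` and a complex `K` (indexed by `ℤ`, differentials of degree `-1`), the complex
of abelian groups `Hom(E, K)`. -/
abbrev homComplex (E : C) (K : ChainComplex C ℤ) : ChainComplex AddCommGrpCat.{v} ℤ :=
  ((preadditiveCoyoneda.obj (Opposite.op E)).mapHomologicalComplex (ComplexShape.down ℤ)).obj K

/-- A totally acyclic complex of injective objects. -/
structure IsTotallyAcyclic (K : ChainComplex C ℤ) : Prop where
  injective : ∀ i : ℤ, Injective (K.X i)
  acyclic : K.Acyclic
  hom_acyclic : ∀ E : C, Injective E → (homComplex E K).Acyclic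

variable (C) in
/-- The class of Gorenstein injective objects: those isomorphic to the kernel `Z₀` of the
differential `K₀ ⟶ K₋₁` of some totally acyclic complex `K` of injective objects. -/
def gorensteinInjective : ObjectProperty C := fun G =>
  ∃ K : ChainComplex C ℤ, IsTotallyAcyclic K ∧ Nonempty (G ≅ K.cycles 0)

end General

theorem isIso_of_isIso_left_right {A : Type u₁} [Category.{v₁} A] {B : Type u₂} [Category.{v₂} B]
    {T : A ⥤ B} {M N : Comma (𝟭 B) T} (f : M ⟶ N) (hl : IsIso f.left) (hr : IsIso f.right) :
    IsIso f :=
  (Comma.isoMk (asIso f.left) (asIso f.right) (by simpa using f.w)).isIso_hom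

section Functor

variable {A : Type u₁} [Category.{v₁} A] [Abelian A] {B : Type u₂} [Category.{v₂} B] [Abelian B]
  (T : A ⥤ B) [T.Additive]

/-- `T` is `X`-exact: it preserves exactness of every short exact sequence in `A` whose first
term lies in `X`. -/
def IsExactOn (X : ObjectProperty A) : Prop :=
  ∀ S : ShortComplex A, S.ShortExact → X S.X₁ → (S.map T).ShortExact

/-- Cocompatibility of a functor. -/
structure IsCocompatible : Prop where
  map_acyclic : ∀ E : ChainComplex A ℤ, (∀ i : ℤ, Injective (E.X i)) → E.Acyclic →
    ((T.mapHomologicalComplex (ComplexShape.down ℤ)).obj E).Acyclic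
  hom_acyclic : ∀ (I : A) (J : ChainComplex B ℤ), Injective I → IsTotallyAcyclic J →
    (homComplex (T.obj I) J).Acyclic

/-- The comma category `(B ↓ T)`: its objects are triples `(B, A, φ : B ⟶ T A)`, with `B` as `left`,
`A` as `right` and `φ` as `hom`. -/
abbrev CommaCat : Type (max u₂ u₁ v₂) := Comma (𝟭 B) T

/-- The functor `h(A, B) = (A, B ⊕ T A)` with the projection `B ⊕ T A ⟶ T A` as structure map. -/
@[simps]
def h : A × B ⥤ CommaCat T where
  obj P :=
    { left := P.2 ⊞ T.obj P.1
      right := P.1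
      hom := biprod.snd }
  map f :=
    { left := biprod.map f.2 (T.map f.1)
      right := f.1 }

/-- The class `h(X, Y)` of all objects `h(A, B)` with `A` in `X` and `B` in `Y`. -/
def hClass (X : ObjectProperty A) (Y : ObjectProperty B) : ObjectProperty (CommaCat T) := fun M =>
  ∃ (a : A) (b : B), X a ∧ Y b ∧ M = (h T).obj (a, b)

variable [PreservesFiniteLimits T]

instance : PreservesFiniteColimits (Comma.fst (𝟭 B) T) where
  preservesFiniteColimits _ _ _ := inferInstance

instance : PreservesFiniteColimits (Comma.snd (𝟭 B) T) where
  preservesFiniteColimits _ _ _ := inferInstance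

instance : PreservesFiniteLimits (Comma.fst (𝟭 B) T) where
  preservesFiniteLimits _ _ _ := ⟨fun {_} =>
    preservesLimit_of_preserves_limit_cone
      (Comma.coneOfPreservesIsLimit _ (limit.isLimit _) (limit.isLimit _)) (limit.isLimit _)⟩

instance : PreservesFiniteLimits (Comma.snd (𝟭 B) T) where
  preservesFiniteLimits _ _ _ := ⟨fun {_} =>
    preservesLimit_of_preserves_limit_cone
      (Comma.coneOfPreservesIsLimit _ (limit.isLimit _) (limit.isLimit _)) (limit.isLimit _)⟩

theorem isIso_coimageImageComparison {M N : CommaCat T} (f : M ⟶ N) :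
    IsIso (Abelian.coimageImageComparison f) := by
  apply isIso_of_isIso_left_right
  · change IsIso ((Comma.fst (𝟭 B) T).map (Abelian.coimageImageComparison f))
    have e := Abelian.PreservesCoimageImageComparison.iso (Comma.fst (𝟭 B) T) f
    exact (Arrow.isIso_iff_isIso_of_isIso e.hom).2 inferInstance
  · change IsIso ((Comma.snd (𝟭 B) T).map (Abelian.coimageImageComparison f))
    have e := Abelian.PreservesCoimageImageComparison.iso (Comma.snd (𝟭 B) T) f
    exact (Arrow.isIso_iff_isIso_of_isIso e.hom).2 inferInstance

/-- The comma category `(B ↓ T)` of a left exact additive functor is abelian. -/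
instance commaAbelian : Abelian (CommaCat T) :=
  haveI := fun {M N : CommaCat T} (f : M ⟶ N) => isIso_coimageImageComparison T f
  Abelian.ofCoimageImageComparisonIsIso

end Functor

end CommaPreenvelope

end

/-!
If `0 ⟶ X ⟶ I ⟶ Q ⟶ 0` is exact with `I` injective, then `Ext¹(M, X) = 0` means that every morphism
`M ⟶ Q` lifts to `I`. In this form two facts about the comma category are immediate, because
`b ↦ (0, b)` and `a ↦ (a, T a)` are right adjoint to `(A, B) ↦ B` and `(A, B) ↦ A` and preserve
injectives. For `M = (A, B)` with structure map `B ⟶ T A`,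
`Ext¹(M, (0, b))` vanishes if and only if `Ext¹(B, b)` does, and, if `T` is exact on the short exact
sequences that start with `a`, `Ext¹(M, (a, T a))` vanishes if and only if `Ext¹(A, a)` does. Since
`h(a, b)` is an extension of `(a, T a)` by `(0, b)`, the class `⊥⟨h(X, Y)⟩` consists of the objects
with components in `⊥X` and `⊥Y`, and `⟨h(X, Y)⟩` itself, for `X` and `Y` closed under extensions,
of the objects with component in `A` in `X` and with epimorphic structure map with kernel in `Y`
(`leftPerp_extensionClosure_hClass_iff`, `hom_of_extensionClosure`,
`extensionClosure_of_shortExact`).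

Given special preenvelopes in `A` and `B`, one for `M` is obtained from a special preenvelope
`A ⟶ a` and a factorization of `B ⟶ T A ⟶ T a` into a monomorphism with cokernel in `⊥Y` and an
epimorphism with kernel in `Y` (`exists_factorization`; this is where projectives are needed).
Conversely, a special preenvelope of `(a, T a)` restricts to one of `a`. A special preenvelope `L`
of `(0, b)` has its component in `A` in `X ∩ ⊥X`, so its structure map splits, and the kernel of
this map is a special preenvelope of `b`.

For the Gorenstein injective objects, the point is that `⟨h(GI, GI)⟩` is the class of Gorenstein
injective objects of the comma category (`IsCocompatible.extensionClosure_gorensteinInjective`), to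
which the first part applies. Totally acyclic complexes are avoided by a coinductive description:
the Gorenstein injective objects form the largest class `G` whose members are both first and last
terms of short exact sequences with injective middle term and other outer term in `G`, and satisfy
`Ext¹(E, -) = 0` for all injective `E` (`IsGorensteinResolving.le_gorensteinInjective`,
`isGorensteinResolving_gorensteinInjective`). Closure under extensions, the inclusion of the objects
`(0, b)` and `(a, T a)`, and the description of the components of a Gorenstein injective object of
the comma category all follow by exhibiting such classes. Cocompatibility says that `T` is exact on
the sequences concerned and that `Ext¹(T I, b) = 0` for `I` injective and `b` Gorenstein injective
(`IsCocompatible.isExactOn`, `IsCocompatible.extVanishes`).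
-/

noncomputable section

namespace CommaPreenvelope

/-! ### Vanishing of `Ext¹` -/

section Ext

variable {C : Type u} [Category.{v} C] [Abelian C]

/-- A short complex `X ⟶ Y ⟶ Z` whose first map is mono, whose second map is epi, and through whose
first map every morphism into `Y` killed by the second one factors, is short exact. -/
theorem shortExact_of_exists_lift (S : ShortComplex C) (hf : Mono S.f) (hg : Epi S.g)
    (h : ∀ ⦃W : C⦄ (x : W ⟶ S.X₂), x ≫ S.g = 0 → ∃ y : W ⟶ S.X₁, y ≫ S.f = x) :
    S.ShortExact where
  exact := by
    rw [S.exact_iff_exact_up_to_refinements]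
    intro W x hx
    obtain ⟨y, hy⟩ := h x hx
    exact ⟨W, 𝟙 W, inferInstance, y, by simp [hy]⟩

theorem shortExact_kernel {X Y : C} (p : X ⟶ Y) [Epi p] :
    (ShortComplex.mk (kernel.ι p) p (kernel.condition p)).ShortExact :=
  shortExact_of_exists_lift _ inferInstance inferInstance
    fun _ x hx => ⟨kernel.lift p x hx, kernel.lift_ι _ _ _⟩

theorem shortExact_cokernel {X Y : C} (i : X ⟶ Y) [Mono i] :
    (ShortComplex.mk i (cokernel.π i) (cokernel.condition i)).ShortExact where
  exact := ShortComplex.exact_cokernel i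

theorem shortExact_of_iso_left {M' M Y Z : C} {f : M ⟶ Y} {g : Y ⟶ Z} {w : f ≫ g = 0}
    (hS : (ShortComplex.mk f g w).ShortExact) (e : M' ≅ M) :
    (ShortComplex.mk (e.hom ≫ f) g (by simp [w])).ShortExact := by
  have e' : ShortComplex.mk f g w ≅ ShortComplex.mk (e.hom ≫ f) g (by simp [w]) :=
    ShortComplex.isoMk e.symm (Iso.refl _) (Iso.refl _) (by simp) (by simp)
  exact ShortComplex.shortExact_of_iso e' hS

/-- The last term of a short exact sequence is the cokernel of its first map. -/
def cokernelIsoOfShortExact {S : ShortComplex C} (hS : S.ShortExact) : cokernel S.f ≅ S.X₃ :=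
  (cokernelIsCokernel S.f).coconePointUniqueUpToIso hS.gIsCokernel

/-- The first term of a short exact sequence is the kernel of its last map. -/
def kernelIsoOfShortExact {S : ShortComplex C} (hS : S.ShortExact) : kernel S.g ≅ S.X₁ :=
  (kernelIsKernel S.g).conePointUniqueUpToIso hS.fIsKernel

/-- `Ext¹(M, X) = 0`, for the same choice of universe of `Ext`-groups as in `leftPerp`, so that
`leftPerp P M` unfolds to `∀ X, P X → ExtVanishes M X`. -/
def ExtVanishes (M X : C) : Prop :=
  let _ := HasExt.standard C
  Subsingleton (Abelian.Ext.{max u v} M X 1)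

variable {M X : C} {S : ShortComplex C}

theorem ExtVanishes.exists_lift (hS : S.ShortExact) (h : ExtVanishes M S.X₁) (f : M ⟶ S.X₃) :
    ∃ g : M ⟶ S.X₂, g ≫ S.g = f := by
  let _ := HasExt.standard C
  have : Subsingleton (Abelian.Ext.{max u v} M S.X₁ 1) := h
  obtain ⟨x, hx⟩ := Abelian.Ext.covariant_sequence_exact₃ M hS (Abelian.Ext.mk₀ f)
    (zero_add 1) (Subsingleton.elim _ _)
  obtain ⟨g, rfl⟩ := Abelian.Ext.addEquiv₀.symm.surjective x
  refine ⟨g, Abelian.Ext.addEquiv₀.symm.injective ?_⟩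
  simpa using hx

/-- Dimension shifting: if `0 ⟶ X ⟶ I ⟶ Q ⟶ 0` is exact with `I` injective and every morphism
`M ⟶ Q` lifts to `I`, then `Ext¹(M, X) = 0`. -/
theorem extVanishes_of_exists_lift (hS : S.ShortExact) (hI : Injective S.X₂)
    (h : ∀ f : M ⟶ S.X₃, ∃ g : M ⟶ S.X₂, g ≫ S.g = f) : ExtVanishes M S.X₁ := by
  let _ := HasExt.standard C
  refine subsingleton_of_forall_eq (0 : Abelian.Ext.{max u v} M S.X₁ 1) fun x => ?_
  obtain ⟨y, rfl⟩ := Abelian.Ext.covariant_sequence_exact₁ M hS x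
    (Abelian.Ext.eq_zero_of_injective _) (zero_add 1)
  obtain ⟨f, rfl⟩ := Abelian.Ext.addEquiv₀.symm.surjective y
  obtain ⟨g, rfl⟩ := h f
  simp only [Abelian.Ext.addEquiv₀_symm_apply, ← Abelian.Ext.mk₀_comp_mk₀]
  rw [Abelian.Ext.comp_assoc _ _ _ (zero_add 0) (zero_add 1) (by simp), hS.comp_extClass,
    Abelian.Ext.comp_zero]

theorem ExtVanishes.of_shortExact_right (hS : S.ShortExact) (h₁ : ExtVanishes M S.X₁)
    (h₃ : ExtVanishes M S.X₃) : ExtVanishes M S.X₂ := by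
  let _ := HasExt.standard C
  have : Subsingleton (Abelian.Ext.{max u v} M S.X₁ 1) := h₁
  have : Subsingleton (Abelian.Ext.{max u v} M S.X₃ 1) := h₃
  refine subsingleton_of_forall_eq (0 : Abelian.Ext.{max u v} M S.X₂ 1) fun x => ?_
  obtain ⟨y, rfl⟩ := Abelian.Ext.covariant_sequence_exact₂ M hS x (Subsingleton.elim _ _)
  rw [Subsingleton.elim y 0, Abelian.Ext.zero_comp]

theorem ExtVanishes.of_shortExact_left (hS : S.ShortExact) (h₁ : ExtVanishes S.X₁ X)
    (h₃ : ExtVanishes S.X₃ X) : ExtVanishes S.X₂ X := by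
  let _ := HasExt.standard C
  have : Subsingleton (Abelian.Ext.{max u v} S.X₁ X 1) := h₁
  have : Subsingleton (Abelian.Ext.{max u v} S.X₃ X 1) := h₃
  refine subsingleton_of_forall_eq (0 : Abelian.Ext.{max u v} S.X₂ X 1) fun x => ?_
  obtain ⟨y, rfl⟩ := Abelian.Ext.contravariant_sequence_exact₂ hS X x (Subsingleton.elim _ _)
  rw [Subsingleton.elim y 0, Abelian.Ext.comp_zero]

theorem ExtVanishes.of_retract_left {M' : C} (h : ExtVanishes M X) (i : M' ⟶ M) (r : M ⟶ M')
    (hir : i ≫ r = 𝟙 M') : ExtVanishes M' X := by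
  let _ := HasExt.standard C
  have : Subsingleton (Abelian.Ext.{max u v} M X 1) := h
  refine subsingleton_of_forall_eq (0 : Abelian.Ext.{max u v} M' X 1) fun x => ?_
  have h1 : (Abelian.Ext.mk₀ i).comp ((Abelian.Ext.mk₀ r).comp x (zero_add 1))
      (zero_add 1) = x := by
    simp [hir]
  rw [← h1, Subsingleton.elim ((Abelian.Ext.mk₀ r).comp x (zero_add 1)) 0, Abelian.Ext.comp_zero]

theorem ExtVanishes.of_iso_left {M' : C} (h : ExtVanishes M X) (e : M' ≅ M) : ExtVanishes M' X :=
  h.of_retract_left e.hom e.inv e.hom_inv_id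

theorem ExtVanishes.of_iso_right {X' : C} (h : ExtVanishes M X) (e : X' ≅ X) :
    ExtVanishes M X' := by
  let _ := HasExt.standard C
  have : Subsingleton (Abelian.Ext.{max u v} M X 1) := h
  refine subsingleton_of_forall_eq (0 : Abelian.Ext.{max u v} M X' 1) fun x => ?_
  have h1 : (x.comp (Abelian.Ext.mk₀ e.hom) (add_zero 1)).comp (Abelian.Ext.mk₀ e.inv)
      (add_zero 1) = x := by
    simp
  rw [← h1, Subsingleton.elim (x.comp (Abelian.Ext.mk₀ e.hom) (add_zero 1)) 0,
    Abelian.Ext.zero_comp]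

theorem extVanishes_of_projective [Projective M] : ExtVanishes M X := by
  let _ := HasExt.standard C
  exact subsingleton_of_forall_eq (0 : Abelian.Ext.{max u v} M X 1)
    fun x => Abelian.Ext.eq_zero_of_projective x

theorem leftPerp_of_iso {P : ObjectProperty C} {M' : C} (h : leftPerp P M) (e : M' ≅ M) :
    leftPerp P M' :=
  fun X hX => ExtVanishes.of_iso_left (h X hX) e

/-- Passing from `P` to its extension closure does not change the left orthogonal class. -/
theorem leftPerp_extensionClosure {P : ObjectProperty C} (h : leftPerp P M) :
    leftPerp (extensionClosure P) M := by
  intro X hX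
  induction hX with
  | of N hN => exact h N hN
  | ext S hS _ _ h₁ h₃ => exact ExtVanishes.of_shortExact_right hS h₁ h₃

theorem IsSpecialPreenveloping.exists_shortExact {P : ObjectProperty C}
    (h : IsSpecialPreenveloping P) (M : C) :
    ∃ (Y Q : C) (g : M ⟶ Y) (p : Y ⟶ Q) (w : g ≫ p = 0),
      (ShortComplex.mk g p w).ShortExact ∧ P Y ∧ leftPerp P Q := by
  obtain ⟨Y, g, hg⟩ := h M
  have := hg.mono
  exact ⟨_, _, _, _, _, shortExact_cokernel g, hg.mem, hg.cokernel_mem⟩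

theorem isSpecialPreenvelope_of_shortExact {P : ObjectProperty C} (hS : S.ShortExact)
    (h₂ : P S.X₂) (h₃ : leftPerp P S.X₃) : IsSpecialPreenvelope P S.f where
  mono := hS.mono_f
  mem := h₂
  cokernel_mem := leftPerp_of_iso h₃ (cokernelIsoOfShortExact hS)

theorem leftPerp_kernel_of_section {P : ObjectProperty C} {N : C} (hM : leftPerp P M) (p : M ⟶ N)
    (s : N ⟶ M) (hs : s ≫ p = 𝟙 N) : leftPerp P (kernel p) := fun Y hY =>
  ExtVanishes.of_retract_left (hM Y hY) (kernel.ι p)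
    (kernel.lift p (𝟙 M - p ≫ s) (by simp [hs])) (by rw [← cancel_mono (kernel.ι p)]; simp)

/-- A property that is closed under extensions and holds for some zero object is stable under
isomorphisms. -/
theorem prop_of_iso_of_closedUnderExtensions {P : ObjectProperty C} (hz : P.ContainsZero)
    (hP : ∀ S : ShortComplex C, S.ShortExact → P S.X₁ → P S.X₃ → P S.X₂) {M N : C} (e : M ≅ N)
    (hM : P M) : P N := by
  obtain ⟨Z, hZ, hPZ⟩ := hz.exists_zero
  refine hP (ShortComplex.mk (0 : Z ⟶ N) e.inv zero_comp)
    (shortExact_of_exists_lift _ ⟨fun _ _ _ => hZ.eq_of_tgt _ _⟩ inferInstance ?_) hPZ hM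
  intro W x hx
  exact ⟨0, by simpa using (((cancel_mono e.inv).1 (hx.trans zero_comp.symm)).symm)⟩

end Ext

/-! ### Splicing short exact sequences with injective middle terms -/

section Splice

variable {C : Type u} [Category.{v} C] [Abelian C]

/-- There is a short exact sequence `0 ⟶ M ⟶ I ⟶ N ⟶ 0` with `I` injective. -/
def InjLinked (M N : C) : Prop :=
  ∃ (I : C) (i : M ⟶ I) (p : I ⟶ N) (w : i ≫ p = 0),
    (ShortComplex.mk i p w).ShortExact ∧ Injective I

theorem InjLinked.of_iso {M N M' N' : C} (h : InjLinked M N) (e : M' ≅ M) (f : N ≅ N') :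
    InjLinked M' N' := by
  obtain ⟨I, i, p, w, hS, hI⟩ := h
  refine ⟨I, e.hom ≫ i, p ≫ f.hom, by simp [reassoc_of% w], ?_, hI⟩
  have e' : ShortComplex.mk i p w ≅ ShortComplex.mk (e.hom ≫ i) (p ≫ f.hom)
      (by simp [reassoc_of% w]) :=
    ShortComplex.isoMk e.symm (Iso.refl _) f (by simp) (by simp)
  exact ShortComplex.shortExact_of_iso e' hS

/-- A class of objects each of whose members is both the first and the last term of a short exact
sequence with injective middle term and with the other outer term in the class. Its members are
the cycles of acyclic complexes of injective objects. -/
structure IsInjResolving (G : ObjectProperty C) : Prop where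
  exists_right : ∀ M, G M → ∃ N, G N ∧ InjLinked M N
  exists_left : ∀ M, G M → ∃ N, G N ∧ InjLinked N M

/-- A relation in which every element has a successor and a predecessor contains a two-sided
infinite chain through any given element. -/
theorem exists_int_chain {α : Type*} (P : α → Prop) (R : α → α → Prop)
    (hr : ∀ a, P a → ∃ b, P b ∧ R a b) (hl : ∀ a, P a → ∃ b, P b ∧ R b a) (a : α) (ha : P a) :
    ∃ f : ℤ → α, f 1 = a ∧ (∀ n, P (f n)) ∧ ∀ n, R (f (n + 1)) (f n) := by
  choose! r hrP hrR using hr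
  choose! l hlP hlR using hl
  have hrn : ∀ n : ℕ, P (r^[n] a) := fun n => by
    induction n with
    | zero => exact ha
    | succ n ih => rw [Function.iterate_succ_apply']; exact hrP _ ih
  have hln : ∀ n : ℕ, P (l^[n] a) := fun n => by
    induction n with
    | zero => exact ha
    | succ n ih => rw [Function.iterate_succ_apply']; exact hlP _ ih
  refine ⟨fun n => if 1 ≤ n then l^[(n - 1).toNat] a else r^[(1 - n).toNat] a, by simp,
    fun n => ?_, fun n => ?_⟩
  · dsimp only
    split_ifs
    exacts [hln _, hrn _]
  · by_cases h : 1 ≤ n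
    · have h1 : (n + 1 - 1).toNat = (n - 1).toNat + 1 := by lia
      have h2 : 1 ≤ n + 1 := by lia
      simp only [h, h2, if_true, h1, Function.iterate_succ_apply']
      exact hlR _ (hln _)
    · obtain ⟨m, rfl⟩ : ∃ m : ℕ, n = -m := ⟨(-n).toNat, by lia⟩
      rcases m with _ | m
      · simpa using hrR a ha
      · have h2 : ¬ (1 : ℤ) ≤ -((m + 1 : ℕ) : ℤ) + 1 := by lia
        have h3 : (1 - -((m + 1 : ℕ) : ℤ)).toNat = (m + 1) + 1 := by lia
        have h4 : (1 - (-((m + 1 : ℕ) : ℤ) + 1)).toNat = m + 1 := by lia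
        simp only [h, h2, if_false, h3, h4, Function.iterate_succ_apply' r (m + 1)]
        exact hrR _ (hrn _)

/-- A decomposition of the complex `K` of injective objects into short exact sequences
`0 ⟶ Zₙ₊₁ ⟶ Kₙ ⟶ Zₙ ⟶ 0`. -/
structure InjSplice (K : ChainComplex C ℤ) where
  Z : ℤ → C
  i (n : ℤ) : Z (n + 1) ⟶ K.X n
  p (n : ℤ) : K.X n ⟶ Z n
  w (n : ℤ) : i n ≫ p n = 0
  shortExact (n : ℤ) : (ShortComplex.mk (i n) (p n) (w n)).ShortExact
  injective (n : ℤ) : Injective (K.X n)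
  fac (n : ℤ) : p (n + 1) ≫ i n = K.d (n + 1) n

/-- The object `M` is placed at `Z₁`, because `Z₁` is the object of zero cycles of the complex. -/
theorem IsInjResolving.exists_splice {G : ObjectProperty C} (hG : IsInjResolving G) {M : C}
    (hM : G M) : ∃ (K : ChainComplex C ℤ) (s : InjSplice K), s.Z 1 = M ∧ ∀ n, G (s.Z n) := by
  obtain ⟨Z, h1, hZ, hR⟩ := exists_int_chain G InjLinked hG.exists_right hG.exists_left M hM
  choose I i p w hS hI using hR
  exact ⟨ChainComplex.of I (fun n => p (n + 1) ≫ i n) (fun n => by simp [reassoc_of% (w (n + 1))]),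
    ⟨Z, i, p, w, hS, hI, fun n => (ChainComplex.of_d I (fun n => p (n + 1) ≫ i n) n).symm⟩, h1, hZ⟩

theorem exactAt_succ_iff (K : ChainComplex C ℤ) (n : ℤ) :
    K.ExactAt (n + 1) ↔ ∀ ⦃W : C⦄ (x : W ⟶ K.X (n + 1)), x ≫ K.d (n + 1) n = 0 →
      ∃ (W' : C) (π : W' ⟶ W) (_ : Epi π) (y : W' ⟶ K.X (n + 1 + 1)),
        π ≫ x = y ≫ K.d (n + 1 + 1) (n + 1) :=
  K.exactAt_iff_exact_up_to_refinements (n + 1 + 1) (n + 1) n (by simp) (by simp)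

theorem homComplex_acyclic_iff (E : C) (K : ChainComplex C ℤ) :
    (homComplex E K).Acyclic ↔ ∀ (n : ℤ) (x : E ⟶ K.X (n + 1)), x ≫ K.d (n + 1) n = 0 →
      ∃ y : E ⟶ K.X (n + 1 + 1), y ≫ K.d (n + 1 + 1) (n + 1) = x := by
  have key : ∀ n : ℤ, (homComplex E K).ExactAt (n + 1) ↔
      ∀ (x : E ⟶ K.X (n + 1)), x ≫ K.d (n + 1) n = 0 →
        ∃ y : E ⟶ K.X (n + 1 + 1), y ≫ K.d (n + 1 + 1) (n + 1) = x := fun n => by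
    rw [(homComplex E K).exactAt_iff' (n + 1 + 1) (n + 1) n (by simp) (by simp),
      ShortComplex.ab_exact_iff]
    rfl
  refine ⟨fun h n => (key n).1 (h _), fun h n => ?_⟩
  obtain ⟨m, rfl⟩ : ∃ m, n = m + 1 := ⟨n - 1, by lia⟩
  exact (key m).2 (h m)

namespace InjSplice

variable {K : ChainComplex C ℤ} (s : InjSplice K)

instance (n : ℤ) : Mono (s.i n) := (s.shortExact n).mono_f

instance (n : ℤ) : Epi (s.p n) := (s.shortExact n).epi_g

include s

theorem exists_comp_i_eq {n : ℤ} {W : C} (x : W ⟶ K.X (n + 1)) (hx : x ≫ K.d (n + 1) n = 0) :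
    ∃ y, y ≫ s.i (n + 1) = x := by
  rw [← s.fac, ← Category.assoc] at hx
  have hx' := (cancel_mono (s.i n)).1 (hx.trans zero_comp.symm)
  exact ⟨(s.shortExact (n + 1)).exact.lift x hx', (s.shortExact (n + 1)).exact.lift_f x hx'⟩

theorem i_comp_d (n : ℤ) : s.i (n + 1) ≫ K.d (n + 1) n = 0 := by
  rw [← s.fac, reassoc_of% (s.w (n + 1)), zero_comp]

theorem acyclic : K.Acyclic := by
  intro n
  obtain ⟨m, rfl⟩ : ∃ m, n = m + 1 := ⟨n - 1, by lia⟩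
  rw [exactAt_succ_iff]
  intro W x hx
  obtain ⟨y, rfl⟩ := s.exists_comp_i_eq x hx
  obtain ⟨W', π, hπ, z, hz⟩ := surjective_up_to_refinements_of_epi (s.p (m + 1 + 1)) y
  exact ⟨W', π, hπ, z, by rw [← s.fac, reassoc_of% hz]⟩

theorem nonempty_iso_cycles (n : ℤ) : Nonempty (s.Z (n + 1) ≅ K.cycles n) := by
  obtain ⟨m, rfl⟩ : ∃ m, n = m + 1 := ⟨n - 1, by lia⟩
  exact ⟨IsLimit.conePointUniqueUpToIso
    (KernelFork.IsLimit.ofι' (s.i (m + 1)) (s.i_comp_d m) fun {W} x hx =>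
      ⟨(s.exists_comp_i_eq x hx).choose, (s.exists_comp_i_eq x hx).choose_spec⟩)
    (K.cyclesIsKernel (m + 1) m (by simp))⟩

theorem homComplex_acyclic (E : C) (h : ∀ n, ExtVanishes E (s.Z n)) :
    (homComplex E K).Acyclic := by
  rw [homComplex_acyclic_iff]
  intro n x hx
  obtain ⟨y, rfl⟩ := s.exists_comp_i_eq x hx
  obtain ⟨z, rfl⟩ := (h (n + 1 + 1 + 1)).exists_lift (s.shortExact (n + 1 + 1)) y
  exact ⟨z, by rw [← s.fac, Category.assoc]⟩

theorem extVanishes_of_homComplex_acyclic (E : C) (h : (homComplex E K).Acyclic) (n : ℤ) :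
    ExtVanishes E (s.Z n) := by
  rw [homComplex_acyclic_iff] at h
  obtain ⟨m, rfl⟩ : ∃ m, n = m + 1 + 1 + 1 := ⟨n - 3, by lia⟩
  refine extVanishes_of_exists_lift (s.shortExact (m + 1 + 1)) (s.injective _)
    fun (f : E ⟶ s.Z (m + 1 + 1)) => ?_
  obtain ⟨y, hy⟩ := h m (f ≫ s.i (m + 1)) (by rw [Category.assoc, s.i_comp_d, comp_zero])
  refine ⟨y, (cancel_mono (s.i (m + 1))).1 ?_⟩
  rw [Category.assoc, ← hy]
  exact congrArg (y ≫ ·) (s.fac (m + 1))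

end InjSplice

end Splice

/-! ### Gorenstein injective objects -/

section Gorenstein

variable {C : Type u} [Category.{v} C] [Abelian C]

/-- A class as in `IsInjResolving` whose members are moreover right orthogonal to all injective
objects. The Gorenstein injective objects form the largest such class. -/
structure IsGorensteinResolving (G : ObjectProperty C) : Prop extends IsInjResolving G where
  extVanishes : ∀ M, G M → ∀ E, Injective E → ExtVanishes E M

theorem InjSplice.isTotallyAcyclic {K : ChainComplex C ℤ} (s : InjSplice K)
    (h : ∀ n E, Injective E → ExtVanishes E (s.Z n)) : IsTotallyAcyclic K where
  injective := s.injective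
  acyclic := s.acyclic
  hom_acyclic E hE := s.homComplex_acyclic E fun n => h n E hE

/-- Coinduction principle for Gorenstein injective objects: membership in any class as in
`IsGorensteinResolving` suffices. -/
theorem IsGorensteinResolving.le_gorensteinInjective {G : ObjectProperty C}
    (hG : IsGorensteinResolving G) : G ≤ gorensteinInjective C := by
  intro M hM
  obtain ⟨K, s, rfl, hs⟩ := hG.exists_splice hM
  exact ⟨K, s.isTotallyAcyclic fun n => hG.extVanishes _ (hs n), s.nonempty_iso_cycles 0⟩

theorem shortExact_cycles {K : ChainComplex C ℤ} (hK : K.Acyclic) (n : ℤ) :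
    ∃ w, (ShortComplex.mk (K.iCycles (n + 1)) (K.toCycles (n + 1) n) w).ShortExact := by
  have hw : K.iCycles (n + 1) ≫ K.toCycles (n + 1) n = 0 := by
    rw [← cancel_mono (K.iCycles n)]; simp
  refine ⟨hw, shortExact_of_exists_lift _ inferInstance ?_ fun W x hx => ?_⟩
  · rw [epi_iff_surjective_up_to_refinements]
    intro W y
    obtain ⟨m, rfl⟩ : ∃ m, n = m + 1 := ⟨n - 1, by lia⟩
    obtain ⟨W', π, hπ, z, hz⟩ := (exactAt_succ_iff K m).1 (hK _) (y ≫ K.iCycles _) (by simp)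
    exact ⟨W', π, hπ, z, by rw [← cancel_mono (K.iCycles _)]; simpa using hz⟩
  · have hx' : x ≫ K.d (n + 1) n = 0 := by
      rw [← K.toCycles_i, ← Category.assoc]
      exact (congrArg (· ≫ K.iCycles n) hx).trans zero_comp
    exact ⟨K.liftCycles x n (by simp) hx', K.liftCycles_i _ _ _ _⟩

theorem injLinked_cycles {K : ChainComplex C ℤ} (hK : K.Acyclic) (n : ℤ)
    (hI : Injective (K.X (n + 1))) : InjLinked (K.cycles (n + 1)) (K.cycles n) :=
  let ⟨w, h⟩ := shortExact_cycles hK n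
  ⟨_, _, _, w, h, hI⟩

theorem isGorensteinResolving_cycles {K : ChainComplex C ℤ} (hK : IsTotallyAcyclic K) :
    IsGorensteinResolving (fun M => ∃ n, Nonempty (M ≅ K.cycles n)) where
  exists_right := by
    rintro M ⟨n, ⟨e⟩⟩
    obtain ⟨m, rfl⟩ : ∃ m, n = m + 1 := ⟨n - 1, by lia⟩
    exact ⟨_, ⟨m, ⟨Iso.refl _⟩⟩,
      (injLinked_cycles hK.acyclic m (hK.injective _)).of_iso e (Iso.refl _)⟩
  exists_left := by
    rintro M ⟨n, ⟨e⟩⟩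
    exact ⟨_, ⟨n + 1, ⟨Iso.refl _⟩⟩,
      (injLinked_cycles hK.acyclic n (hK.injective _)).of_iso (Iso.refl _) e.symm⟩
  extVanishes := by
    rintro M ⟨n, ⟨e⟩⟩ E hE
    refine ExtVanishes.of_iso_right ?_ e
    obtain ⟨m, rfl⟩ : ∃ m, n = m + 1 + 1 := ⟨n - 2, by lia⟩
    obtain ⟨w, hS⟩ := shortExact_cycles hK.acyclic (m + 1)
    refine extVanishes_of_exists_lift hS (hK.injective _) fun f => ?_
    obtain ⟨y, hy⟩ := (homComplex_acyclic_iff E K).1 (hK.hom_acyclic E hE) m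
      (f ≫ K.iCycles _) (by simp)
    exact ⟨y, by rw [← cancel_mono (K.iCycles _)]; simpa using hy⟩

variable (C) in
theorem isGorensteinResolving_gorensteinInjective :
    IsGorensteinResolving (gorensteinInjective C) where
  exists_right := by
    rintro M ⟨K, hK, e⟩
    obtain ⟨N, hN, h⟩ := (isGorensteinResolving_cycles hK).exists_right M ⟨0, e⟩
    exact ⟨N, (isGorensteinResolving_cycles hK).le_gorensteinInjective N hN, h⟩
  exists_left := by
    rintro M ⟨K, hK, e⟩
    obtain ⟨N, hN, h⟩ := (isGorensteinResolving_cycles hK).exists_left M ⟨0, e⟩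
    exact ⟨N, (isGorensteinResolving_cycles hK).le_gorensteinInjective N hN, h⟩
  extVanishes := by
    rintro M ⟨K, hK, e⟩ E hE
    exact (isGorensteinResolving_cycles hK).extVanishes M ⟨0, e⟩ E hE

theorem gorensteinInjective_of_iso {M N : C} (e : N ≅ M) (h : gorensteinInjective C M) :
    gorensteinInjective C N := by
  obtain ⟨K, hK, ⟨f⟩⟩ := h
  exact ⟨K, hK, ⟨e ≪≫ f⟩⟩

variable (C) in
theorem gorensteinInjective_containsZero : (gorensteinInjective C).ContainsZero := by
  have hlink : ∀ M N : C, IsZero M → IsZero N → InjLinked M N := fun M N hM hN =>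
    ⟨N, 0, 𝟙 N, by simp, shortExact_of_exists_lift _ ⟨fun _ _ _ => hM.eq_of_tgt _ _⟩
      inferInstance fun W x _ => ⟨0, hN.eq_of_tgt _ _⟩, hN.injective⟩
  have h : IsGorensteinResolving (fun M : C => IsZero M) :=
    { exists_right := fun M hM => ⟨M, hM, hlink M M hM hM⟩
      exists_left := fun M hM => ⟨M, hM, hlink M M hM hM⟩
      extVanishes := fun M hM E _ => by
        have : Injective M := hM.injective
        let _ := HasExt.standard C
        exact Abelian.Ext.subsingleton_of_injective E M 0 }
  obtain ⟨Z, hZ⟩ := HasZeroObject.zero (C := C)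
  exact ⟨Z, hZ, h.le_gorensteinInjective _ hZ⟩

end Gorenstein

/-! ### Diagram lemmas for short exact sequences -/

section Diagram

variable {C : Type u} [Category.{v} C] [Abelian C]

/-- The kernels of a morphism of short complexes `S ⟶ S'` form a short exact sequence if `S` is
short exact, `S'` is left exact and `S.X₁ ⟶ S'.X₁` is epi. -/
theorem shortExact_kernels {S S' : ShortComplex C} (φ : S ⟶ S') (hS : S.ShortExact)
    (hS' : S'.Exact) (hf : Mono S'.f) (h₁ : Epi φ.τ₁) :
    (ShortComplex.mk (kernel.map φ.τ₁ φ.τ₂ S.f S'.f φ.comm₁₂)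
      (kernel.map φ.τ₂ φ.τ₃ S.g S'.g φ.comm₂₃)
      (by rw [← cancel_mono (kernel.ι φ.τ₃)]; simp)).ShortExact := by
  have := hS.mono_f
  have := hS.epi_g
  refine shortExact_of_exists_lift _ ?_ ?_ fun W x hx => ?_
  · dsimp
    have : Mono (kernel.map φ.τ₁ φ.τ₂ S.f S'.f φ.comm₁₂ ≫ kernel.ι φ.τ₂) := by
      simpa using mono_comp (kernel.ι φ.τ₁) S.f
    exact mono_of_mono _ (kernel.ι φ.τ₂)
  · dsimp
    rw [epi_iff_surjective_up_to_refinements]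
    intro W x
    obtain ⟨W₁, π₁, _, y, hy⟩ := surjective_up_to_refinements_of_epi S.g (x ≫ kernel.ι φ.τ₃)
    have hy' : (y ≫ φ.τ₂) ≫ S'.g = 0 := by
      rw [Category.assoc, φ.comm₂₃, ← reassoc_of% hy]; simp
    obtain ⟨W₂, π₂, _, z, hz⟩ := surjective_up_to_refinements_of_epi φ.τ₁ (hS'.lift _ hy')
    have hz' : π₂ ≫ y ≫ φ.τ₂ = z ≫ S.f ≫ φ.τ₂ := by
      rw [← φ.comm₁₂, ← reassoc_of% hz, hS'.lift_f]
    refine ⟨W₂, π₂ ≫ π₁, inferInstance, kernel.lift _ (π₂ ≫ y - z ≫ S.f) (by simp [hz']), ?_⟩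
    rw [← cancel_mono (kernel.ι φ.τ₃)]
    simp [hy]
  · have hx' : (x ≫ kernel.ι φ.τ₂) ≫ S.g = 0 := by
      simpa using congrArg (· ≫ kernel.ι φ.τ₃) hx
    refine ⟨kernel.lift _ (hS.exact.lift _ hx') ?_, ?_⟩
    · rw [← cancel_mono S'.f, Category.assoc, φ.comm₁₂, ← Category.assoc, hS.exact.lift_f]
      simp
    · rw [← cancel_mono (kernel.ι φ.τ₂)]
      simp [hS.exact.lift_f]

/-- The cokernels of a morphism of short complexes `S ⟶ S'` form a short exact sequence if `S'` is
short exact, `S` is right exact and `S.X₃ ⟶ S'.X₃` is mono. -/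
theorem shortExact_cokernels {S S' : ShortComplex C} (φ : S ⟶ S') (hS : S.Exact) (hg : Epi S.g)
    (hS' : S'.ShortExact) (h₃ : Mono φ.τ₃) :
    (ShortComplex.mk (cokernel.map φ.τ₁ φ.τ₂ S.f S'.f φ.comm₁₂)
      (cokernel.map φ.τ₂ φ.τ₃ S.g S'.g φ.comm₂₃)
      (by rw [← cancel_epi (cokernel.π φ.τ₁)]; simp)).ShortExact := by
  have := hS'.mono_f
  have := hS'.epi_g
  refine ShortComplex.ShortExact.mk' ?_ ?_ ?_
  · rw [ShortComplex.exact_iff_exact_up_to_refinements]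
    intro W x hx
    dsimp at x hx
    obtain ⟨W₁, π₁, _, y, hy⟩ := surjective_up_to_refinements_of_epi (cokernel.π φ.τ₂) x
    have hy' : (y ≫ S'.g) ≫ cokernel.π φ.τ₃ = 0 := by
      have e : S'.g ≫ cokernel.π φ.τ₃ =
          cokernel.π φ.τ₂ ≫ cokernel.map φ.τ₂ φ.τ₃ S.g S'.g φ.comm₂₃ := by simp
      rw [Category.assoc, e, ← Category.assoc, ← hy, Category.assoc]
      exact (congrArg (π₁ ≫ ·) hx).trans comp_zero
    obtain ⟨W₂, π₂, _, z, hz⟩ := (ShortComplex.exact_cokernel φ.τ₃).exact_up_to_refinements _ hy'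
    obtain ⟨W₃, π₃, _, t, ht⟩ := surjective_up_to_refinements_of_epi S.g z
    dsimp at hz
    have hs : (π₃ ≫ π₂ ≫ y - t ≫ φ.τ₂) ≫ S'.g = 0 := by
      rw [Preadditive.sub_comp, sub_eq_zero]
      simp only [Category.assoc]
      rw [hz, reassoc_of% ht, φ.comm₂₃]
    refine ⟨W₃, π₃ ≫ π₂ ≫ π₁, inferInstance, hS'.exact.lift _ hs ≫ cokernel.π φ.τ₁, ?_⟩
    simp only [Category.assoc, cokernel.π_desc]
    rw [← Category.assoc (hS'.exact.lift _ hs), hS'.exact.lift_f]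
    simp [hy]
  · rw [Preadditive.mono_iff_cancel_zero]
    intro W x hx
    obtain ⟨W₁, π₁, _, y, hy⟩ := surjective_up_to_refinements_of_epi (cokernel.π φ.τ₁) x
    have hy' : (y ≫ S'.f) ≫ cokernel.π φ.τ₂ = 0 := by
      have := congrArg (π₁ ≫ ·) hx
      dsimp only at this
      rw [reassoc_of% hy] at this
      simpa using this
    obtain ⟨W₂, π₂, _, z, hz⟩ := (ShortComplex.exact_cokernel φ.τ₂).exact_up_to_refinements _ hy'
    dsimp at hz
    have hzg : z ≫ S.g = 0 := by
      rw [← cancel_mono φ.τ₃, Category.assoc, ← φ.comm₂₃, ← reassoc_of% hz]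
      simp
    obtain ⟨W₃, π₃, _, t, ht⟩ := hS.exact_up_to_refinements z hzg
    have hyt : π₃ ≫ π₂ ≫ y = t ≫ φ.τ₁ := by
      rw [← cancel_mono S'.f]
      simp only [Category.assoc]
      rw [hz, reassoc_of% ht, φ.comm₁₂]
    rw [← cancel_epi π₁, ← cancel_epi π₂, ← cancel_epi π₃, hy, reassoc_of% hyt]
    simp
  · dsimp
    have : Epi (cokernel.π φ.τ₂ ≫ cokernel.map φ.τ₂ φ.τ₃ S.g S'.g φ.comm₂₃) := by
      simpa using epi_comp S'.g (cokernel.π φ.τ₃)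
    exact epi_of_epi (cokernel.π φ.τ₂) _

/-- A morphism of short exact sequences that is the identity on the first terms has a pullback
square on the right. -/
theorem isPullback_of_shortExact {X Y Z I Q : C} {f : X ⟶ Y} {g : Y ⟶ Z} {w : f ≫ g = 0}
    (hS : (ShortComplex.mk f g w).ShortExact) {i : X ⟶ I} {p : I ⟶ Q} {w' : i ≫ p = 0}
    (hI : (ShortComplex.mk i p w').ShortExact) (a : Y ⟶ I) (b : Z ⟶ Q) (ha : f ≫ a = i)
    (hb : g ≫ b = a ≫ p) : IsPullback a g p b := by
  have : Mono f := hS.mono_f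
  have : Epi g := hS.epi_g
  have : Mono i := hI.mono_f
  have hm : Mono (biprod.lift a g) := by
    rw [Preadditive.mono_iff_cancel_zero]
    intro W x hx
    have hxa : x ≫ a = 0 := by simpa using congrArg (· ≫ biprod.fst) hx
    have hxg : x ≫ g = 0 := by simpa using congrArg (· ≫ biprod.snd) hx
    have hx' : hS.exact.lift x hxg ≫ f = x := hS.exact.lift_f x hxg
    rw [← hx', (cancel_mono i).1 (show hS.exact.lift x hxg ≫ i = 0 ≫ i by
      rw [← ha, reassoc_of% hx', hxa, zero_comp]), zero_comp]
  have hE : (ShortComplex.mk (biprod.lift a g) (biprod.desc p (-b)) (by simp [hb])).Exact := by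
    rw [ShortComplex.exact_iff_exact_up_to_refinements]
    intro W x hx
    dsimp at x hx
    obtain ⟨W', π, _, z, hz⟩ := surjective_up_to_refinements_of_epi g (x ≫ biprod.snd)
    have hx' : x ≫ biprod.fst ≫ p = x ≫ biprod.snd ≫ b := by
      have hd : biprod.desc p (-b) = biprod.fst ≫ p - biprod.snd ≫ b := by ext <;> simp
      have hx₀ := (congrArg (x ≫ ·) hd).symm.trans hx
      simpa [sub_eq_zero] using hx₀
    have ht : (π ≫ x ≫ biprod.fst - z ≫ a) ≫ p = 0 := by
      simp [hx', ← hb, reassoc_of% hz]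
    have ht' : hI.exact.lift _ ht ≫ i = π ≫ x ≫ biprod.fst - z ≫ a := hI.exact.lift_f _ ht
    refine ⟨W', π, inferInstance, z + hI.exact.lift _ ht ≫ f, ?_⟩
    dsimp
    ext
    · simp [ha, ht']
    · simp [w, hz]
  have hl : ∀ s : PullbackCone p b,
      biprod.lift s.fst s.snd ≫ biprod.desc p (-b) = 0 := fun s => by
    simp [s.condition]
  have hl' : ∀ s : PullbackCone p b, hE.lift _ (hl s) ≫ biprod.lift a g = biprod.lift s.fst s.snd :=
    fun s => hE.lift_f _ (hl s)
  refine ⟨⟨hb.symm⟩, ⟨PullbackCone.IsLimit.mk _ (fun s => hE.lift _ (hl s)) (fun s => ?_)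
    (fun s => ?_) fun s m h₁ h₂ => ?_⟩⟩
  · simpa using congrArg (· ≫ biprod.fst) (hl' s)
  · simpa using congrArg (· ≫ biprod.snd) (hl' s)
  · rw [← cancel_mono (biprod.lift a g), hl']
    ext <;> simp [h₁, h₂]

theorem shortExact_biprod (X Y : C) :
    (ShortComplex.mk (biprod.inl : X ⟶ X ⊞ Y) biprod.snd (by simp)).ShortExact :=
  shortExact_of_exists_lift _ inferInstance inferInstance fun W x hx =>
    ⟨x ≫ biprod.fst, by
      dsimp at hx ⊢
      ext <;> simp [hx]⟩

end Diagram

/-! ### Extensions of Gorenstein injective objects -/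

section GorensteinExtensions

variable {C : Type u} [Category.{v} C] [Abelian C]

theorem exists_mono_of_gorensteinInjective {M : C} (hM : gorensteinInjective C M) :
    ∃ (I : C) (i : M ⟶ I), Mono i ∧ Injective I ∧ gorensteinInjective C (cokernel i) := by
  obtain ⟨N, hN, I, i, p, w, hS, hI⟩ :=
    (isGorensteinResolving_gorensteinInjective C).exists_right M hM
  exact ⟨I, i, hS.mono_f, hI, gorensteinInjective_of_iso (cokernelIsoOfShortExact hS) hN⟩

theorem exists_epi_of_gorensteinInjective {M : C} (hM : gorensteinInjective C M) :
    ∃ (I : C) (p : I ⟶ M), Epi p ∧ Injective I ∧ gorensteinInjective C (kernel p) := by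
  obtain ⟨N, hN, I, i, p, w, hS, hI⟩ :=
    (isGorensteinResolving_gorensteinInjective C).exists_left M hM
  exact ⟨I, p, hS.epi_g, hI, gorensteinInjective_of_iso (kernelIsoOfShortExact hS) hN⟩

/-- Extensions of Gorenstein injective objects form a class as in `IsGorensteinResolving`: both
resolutions of such an extension come from the horseshoe lemma. -/
theorem isGorensteinResolving_extensions :
    IsGorensteinResolving (fun M : C => ∃ S : ShortComplex C, S.ShortExact ∧
      gorensteinInjective C S.X₁ ∧ gorensteinInjective C S.X₃ ∧ S.X₂ = M) where
  exists_right := by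
    rintro _ ⟨S, hS, h₁, h₃, rfl⟩
    obtain ⟨I₁, i₁, _, _, hN₁⟩ := exists_mono_of_gorensteinInjective h₁
    obtain ⟨I₃, i₃, _, _, hN₃⟩ := exists_mono_of_gorensteinInjective h₃
    have := hS.mono_f
    let φ : S ⟶ ShortComplex.mk (biprod.inl : I₁ ⟶ I₁ ⊞ I₃) biprod.snd (by simp) :=
      { τ₁ := i₁
        τ₂ := biprod.lift (Injective.factorThru i₁ S.f) (S.g ≫ i₃)
        τ₃ := i₃
        comm₁₂ := by ext <;> simp
        comm₂₃ := by simp }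
    have hφ := shortExact_cokernels φ hS.exact hS.epi_g (shortExact_biprod I₁ I₃) ‹_›
    have : Mono φ.τ₂ := ShortComplex.mono_τ₂_of_exact_of_mono φ hS.exact
    exact ⟨_, ⟨_, hφ, hN₁, hN₃, rfl⟩, _, _, _, _, shortExact_cokernel φ.τ₂,
      inferInstanceAs (Injective (I₁ ⊞ I₃))⟩
  exists_left := by
    rintro _ ⟨S, hS, h₁, h₃, rfl⟩
    obtain ⟨I₁, p₁, _, _, hN₁⟩ := exists_epi_of_gorensteinInjective h₁
    obtain ⟨I₃, p₃, _, _, hN₃⟩ := exists_epi_of_gorensteinInjective h₃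
    obtain ⟨q, hq⟩ := ExtVanishes.exists_lift hS
      ((isGorensteinResolving_gorensteinInjective C).extVanishes _ h₁ I₃ ‹_›) p₃
    let φ : ShortComplex.mk (biprod.inl : I₁ ⟶ I₁ ⊞ I₃) biprod.snd (by simp) ⟶ S :=
      { τ₁ := p₁
        τ₂ := biprod.desc (p₁ ≫ S.f) q
        τ₃ := p₃
        comm₁₂ := by simp
        comm₂₃ := by ext <;> simp [hq] }
    have hφ := shortExact_kernels φ (shortExact_biprod I₁ I₃) hS.exact hS.mono_f ‹_›
    have := hS.epi_g
    have : Epi φ.τ₂ := ShortComplex.epi_τ₂_of_exact_of_epi φ hS.exact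
    exact ⟨_, ⟨_, hφ, hN₁, hN₃, rfl⟩, _, _, _, _, shortExact_kernel φ.τ₂,
      inferInstanceAs (Injective (I₁ ⊞ I₃))⟩
  extVanishes := by
    rintro _ ⟨S, hS, h₁, h₃, rfl⟩ E hE
    exact ExtVanishes.of_shortExact_right hS
      ((isGorensteinResolving_gorensteinInjective C).extVanishes _ h₁ E hE)
      ((isGorensteinResolving_gorensteinInjective C).extVanishes _ h₃ E hE)

theorem gorensteinInjective_of_shortExact {S : ShortComplex C} (hS : S.ShortExact)
    (h₁ : gorensteinInjective C S.X₁) (h₃ : gorensteinInjective C S.X₃) :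
    gorensteinInjective C S.X₂ :=
  isGorensteinResolving_extensions.le_gorensteinInjective _ ⟨S, hS, h₁, h₃, rfl⟩

instance : (gorensteinInjective C).IsClosedUnderExtensions where
  prop_X₂_of_shortExact hS h₁ h₃ := gorensteinInjective_of_shortExact hS h₁ h₃

/-- A Gorenstein injective object that is left orthogonal to the Gorenstein injective objects is
injective. -/
theorem injective_of_gorensteinInjective_of_leftPerp {M : C} (hM : gorensteinInjective C M)
    (h : leftPerp (gorensteinInjective C) M) : Injective M := by
  obtain ⟨I, p, _, _, hN⟩ := exists_epi_of_gorensteinInjective hM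
  obtain ⟨s, hs⟩ := ExtVanishes.exists_lift (shortExact_kernel p) (h _ hN) (𝟙 M)
  exact Retract.injective ⟨s, p, hs⟩

end GorensteinExtensions

/-! ### Exactness properties of left exact and of cocompatible functors -/

section Functor

variable {A : Type u₁} [Category.{v₁} A] [Abelian A] {B : Type u₂} [Category.{v₂} B] [Abelian B]
  {T : A ⥤ B} [T.Additive] [PreservesFiniteLimits T]

theorem exact_map {S : ShortComplex A} (hS : S.ShortExact) : (S.map T).Exact := by
  have := hS.mono_f
  exact hS.exact.map_of_mono_of_preservesKernel T ‹_› inferInstance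

theorem shortExact_map_of_epi {S : ShortComplex A} (hS : S.ShortExact) (h : Epi (T.map S.g)) :
    (S.map T).ShortExact where
  exact := exact_map hS
  mono_f := by
    have := hS.mono_f
    exact inferInstanceAs (Mono (T.map S.f))
  epi_g := h

/-- If `T` is exact on one short exact sequence `0 ⟶ X ⟶ I ⟶ Q ⟶ 0` with `I` injective, then it is
exact on every short exact sequence that starts with `X`: such a sequence is a pullback of the given
one, and `T` preserves pullbacks. -/
theorem shortExact_map_of_injective {S : ShortComplex A} (hS : S.ShortExact) {I Q : A}
    {i : S.X₁ ⟶ I} {p : I ⟶ Q} {w : i ≫ p = 0} (hI : (ShortComplex.mk i p w).ShortExact)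
    (inj : Injective I) (hp : Epi (T.map p)) : (S.map T).ShortExact := by
  have := hS.mono_f
  have := hS.epi_g
  have := hI.mono_f
  let a : S.X₂ ⟶ I := Injective.factorThru i S.f
  have ha : S.f ≫ a = i := Injective.comp_factorThru i S.f
  let b : S.X₃ ⟶ Q := hS.exact.desc (a ≫ p) (by rw [reassoc_of% ha, w])
  have hpb : IsPullback a S.g p b :=
    isPullback_of_shortExact hS hI a b ha (hS.exact.g_desc _ _)
  exact shortExact_map_of_epi hS
    (MorphismProperty.of_isPullback (P := .epimorphisms B) (hpb.map T) hp)

theorem InjSplice.epi_map_p {K : ChainComplex A ℤ} (s : InjSplice K)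
    (hK : ((T.mapHomologicalComplex (ComplexShape.down ℤ)).obj K).Acyclic) (n : ℤ) :
    Epi (T.map (s.p n)) := by
  obtain ⟨m, rfl⟩ : ∃ m, n = m + 1 + 1 := ⟨n - 2, by lia⟩
  have hK' : ∀ ⦃W : B⦄ (x : W ⟶ T.obj (K.X (m + 1))), x ≫ T.map (K.d (m + 1) m) = 0 →
      ∃ (W' : B) (π : W' ⟶ W) (_ : Epi π) (y : W' ⟶ T.obj (K.X (m + 1 + 1))),
        π ≫ x = y ≫ T.map (K.d (m + 1 + 1) (m + 1)) :=
    (exactAt_succ_iff _ m).1 (hK (m + 1))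
  rw [epi_iff_surjective_up_to_refinements]
  intro W y
  obtain ⟨W', π, hπ, z, hz⟩ := hK' (y ≫ T.map (s.i (m + 1))) (by
    rw [Category.assoc, ← T.map_comp, s.i_comp_d, T.map_zero, comp_zero])
  refine ⟨W', π, hπ, z, ?_⟩
  rw [← cancel_mono (T.map (s.i (m + 1))), Category.assoc, hz, ← s.fac, T.map_comp, Category.assoc]

/-- A cocompatible functor is exact on every short exact sequence starting with a cycle of an
acyclic complex of injective objects. -/
theorem IsCocompatible.isExactOn (hT : IsCocompatible T) {G : ObjectProperty A}
    (hG : IsInjResolving G) : IsExactOn T G := by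
  intro S hS h₁
  have key : ∀ M : A, G M → ∃ (I Q : A) (i : M ⟶ I) (p : I ⟶ Q) (w : i ≫ p = 0),
      (ShortComplex.mk i p w).ShortExact ∧ Injective I ∧ Epi (T.map p) := by
    intro M hM
    obtain ⟨K, s, rfl, -⟩ := hG.exists_splice hM
    exact ⟨K.X 0, s.Z 0, s.i 0, s.p 0, s.w 0, s.shortExact 0, s.injective 0,
      s.epi_map_p (hT.map_acyclic K s.injective s.acyclic) 0⟩
  obtain ⟨I, Q, i, p, w, hI, inj, hp⟩ := key _ h₁
  exact shortExact_map_of_injective hS hI inj hp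

omit [PreservesFiniteLimits T] in
theorem IsCocompatible.extVanishes (hT : IsCocompatible T) {I : A} (hI : Injective I) {N : B}
    (hN : gorensteinInjective B N) : ExtVanishes (T.obj I) N := by
  have hG := isGorensteinResolving_gorensteinInjective B
  obtain ⟨K, s, rfl, hs⟩ := hG.exists_splice hN
  exact s.extVanishes_of_homComplex_acyclic _ (hT.hom_acyclic I K hI
    (s.isTotallyAcyclic fun n => hG.extVanishes _ (hs n))) 1

end Functor

/-! ### The comma category -/

section Comma

open ZeroObject

variable {A : Type u₁} [Category.{v₁} A] [Abelian A] {B : Type u₂} [Category.{v₂} B] [Abelian B]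
  {T : A ⥤ B} [T.Additive] [PreservesFiniteLimits T]

omit [Abelian A] [Abelian B] [T.Additive] [PreservesFiniteLimits T] in
theorem mono_of_mono_left_right {M N : CommaCat T} (f : M ⟶ N) (hl : Mono f.left)
    (hr : Mono f.right) : Mono f where
  right_cancellation a b h := by
    ext
    · rw [← cancel_mono f.left, ← Comma.comp_left, h, Comma.comp_left]
    · rw [← cancel_mono f.right, ← Comma.comp_right, h, Comma.comp_right]

omit [Abelian A] [Abelian B] [T.Additive] [PreservesFiniteLimits T] in
theorem epi_of_epi_left_right {M N : CommaCat T} (f : M ⟶ N) (hl : Epi f.left)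
    (hr : Epi f.right) : Epi f where
  left_cancellation a b h := by
    ext
    · rw [← cancel_epi f.left, ← Comma.comp_left, h, Comma.comp_left]
    · rw [← cancel_epi f.right, ← Comma.comp_right, h, Comma.comp_right]

theorem mono_left {M N : CommaCat T} (f : M ⟶ N) [Mono f] : Mono f.left :=
  inferInstanceAs (Mono ((Comma.fst (𝟭 B) T).map f))

theorem mono_right {M N : CommaCat T} (f : M ⟶ N) [Mono f] : Mono f.right :=
  inferInstanceAs (Mono ((Comma.snd (𝟭 B) T).map f))

omit [PreservesFiniteLimits T] in
theorem isZero_of_isZero_left_right {M : CommaCat T} (hl : IsZero M.left) (hr : IsZero M.right) :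
    IsZero M := by
  rw [IsZero.iff_id_eq_zero]
  ext
  · exact hl.eq_of_src _ _
  · exact hr.eq_of_src _ _

/-- Exactness in the comma category is detected componentwise. -/
theorem shortExact_of_left_right {S : ShortComplex (CommaCat T)}
    (hl : (S.map (Comma.fst (𝟭 B) T)).ShortExact) (hr : (S.map (Comma.snd (𝟭 B) T)).ShortExact) :
    S.ShortExact where
  exact := by
    rw [ShortComplex.exact_iff_isZero_homology]
    exact isZero_of_isZero_left_right
      (((S.map _).exact_iff_isZero_homology.1 hl.exact).of_iso
        (S.mapHomologyIso (Comma.fst (𝟭 B) T)).symm)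
      (((S.map _).exact_iff_isZero_homology.1 hr.exact).of_iso
        (S.mapHomologyIso (Comma.snd (𝟭 B) T)).symm)
  mono_f := mono_of_mono_left_right _ hl.mono_f hr.mono_f
  epi_g := epi_of_epi_left_right _ hl.epi_g hr.epi_g

theorem shortExact_left {S : ShortComplex (CommaCat T)} (hS : S.ShortExact) :
    (S.map (Comma.fst (𝟭 B) T)).ShortExact := by
  have := hS.mono_f
  have := hS.epi_g
  exact hS.map _

theorem shortExact_right {S : ShortComplex (CommaCat T)} (hS : S.ShortExact) :
    (S.map (Comma.snd (𝟭 B) T)).ShortExact := by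
  have := hS.mono_f
  have := hS.epi_g
  exact hS.map _

variable (T)

/-- The object `(0, b)` of the comma category. The functor `b ↦ (0, b)` is right adjoint to
`(A, B) ↦ B`. -/
abbrev ofLeft (b : B) : CommaCat T where
  left := b
  right := 0
  hom := 0

/-- The object `(a, T a)` of the comma category, with the identity as structure map. The functor
`a ↦ (a, T a)` is right adjoint to `(A, B) ↦ A`. -/
abbrev ofRight (a : A) : CommaCat T where
  left := T.obj a
  right := a
  hom := 𝟙 _

variable {T}

/-- The morphism `M ⟶ (0, b)` given by a morphism `M.left ⟶ b`. -/
@[simps]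
def toOfLeft {M : CommaCat T} {b : B} (f : M.left ⟶ b) : M ⟶ ofLeft T b where
  left := f
  right := 0
  w := by simp

/-- The morphism `(0, b) ⟶ M` given by a morphism `b ⟶ M.left` killed by the structure map. -/
@[simps]
def ofLeftTo {M : CommaCat T} {b : B} (f : b ⟶ M.left) (hf : f ≫ M.hom = 0) : ofLeft T b ⟶ M where
  left := f
  right := 0
  w := by simpa using hf

/-- The morphism `M ⟶ (a, T a)` given by a morphism `M.right ⟶ a`. -/
@[simps]
def toOfRight {M : CommaCat T} {a : A} (f : M.right ⟶ a) : M ⟶ ofRight T a where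
  left := M.hom ≫ T.map f
  right := f
  w := by simp

omit [Abelian A] [Abelian B] [T.Additive] [PreservesFiniteLimits T] in
theorem ofRight_hom_ext {M : CommaCat T} {a : A} {f g : M ⟶ ofRight T a}
    (h : f.right = g.right) : f = g := by
  ext
  · have hf := f.w
    have hg := g.w
    simp only [Functor.id_obj, Functor.id_map, Category.comp_id] at hf hg
    rw [hf, hg, h]
  · exact h

omit [T.Additive] [PreservesFiniteLimits T] in
theorem ofLeft_hom_ext {M : CommaCat T} {b : B} {f g : M ⟶ ofLeft T b}
    (h : f.left = g.left) : f = g := by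
  ext
  exact h

theorem shortExact_of_isZero {C : Type u} [Category.{v} C] [Abelian C] {S : ShortComplex C}
    (h₁ : IsZero S.X₁) (h₂ : IsZero S.X₂) (h₃ : IsZero S.X₃) : S.ShortExact :=
  shortExact_of_exists_lift _ ⟨fun _ _ _ => h₁.eq_of_tgt _ _⟩ ⟨fun _ _ _ => h₃.eq_of_src _ _⟩
    fun _ _ _ => ⟨0, h₂.eq_of_tgt _ _⟩

/-- A short exact sequence `0 ⟶ X ⟶ Y ⟶ Z ⟶ 0` in `B` gives one of the objects `(0, -)`. -/
theorem exists_shortExact_ofLeft {S : ShortComplex B} (hS : S.ShortExact) :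
    ∃ w, (ShortComplex.mk (toOfLeft S.f : ofLeft T S.X₁ ⟶ ofLeft T S.X₂)
      (toOfLeft S.g : _ ⟶ ofLeft T S.X₃) w).ShortExact :=
  ⟨ofLeft_hom_ext S.zero, shortExact_of_left_right hS
    (shortExact_of_isZero (isZero_zero A) (isZero_zero A) (isZero_zero A))⟩

/-- A short exact sequence in `A` on which `T` is exact gives one of the objects `(a, T a)`. -/
theorem exists_shortExact_ofRight {S : ShortComplex A} (hS : S.ShortExact)
    (hT : (S.map T).ShortExact) :
    ∃ w, (ShortComplex.mk (toOfRight S.f : ofRight T S.X₁ ⟶ ofRight T S.X₂)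
      (toOfRight S.g : _ ⟶ ofRight T S.X₃) w).ShortExact := by
  refine ⟨ofRight_hom_ext S.zero, shortExact_of_left_right ?_ hS⟩
  refine ShortComplex.shortExact_of_iso (S₁ := S.map T) ?_ hT
  exact ShortComplex.isoMk (Iso.refl _) (Iso.refl _) (Iso.refl _)
    (by simp; exact (Category.id_comp (T.map S.f)).trans (Category.comp_id (T.map S.f)).symm)
    (by simp; exact (Category.id_comp (T.map S.g)).trans (Category.comp_id (T.map S.g)).symm)

/-- Every `M` with epimorphic structure map `φ` is an extension of `(A, T A)` by `(0, ker φ)`. -/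
theorem exists_shortExact_of_hom (M : CommaCat T) {b : B} {k : b ⟶ M.left} {w : k ≫ M.hom = 0}
    (hM : (ShortComplex.mk k M.hom w).ShortExact) :
    ∃ w', (ShortComplex.mk (ofLeftTo k w) (toOfRight (𝟙 M.right)) w').ShortExact := by
  refine ⟨ofRight_hom_ext (by simp), shortExact_of_left_right ?_ ?_⟩
  · refine ShortComplex.shortExact_of_iso ?_ hM
    exact ShortComplex.isoMk (Iso.refl _) (Iso.refl _) (Iso.refl _)
      (by simp; exact (Category.id_comp k).trans (Category.comp_id k).symm)
      (by simp; exact (Category.id_comp (M.hom)).trans (Category.comp_id (M.hom)).symm)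
  · exact shortExact_of_exists_lift _ ⟨fun _ _ _ => (isZero_zero A).eq_of_tgt _ _⟩
      (inferInstanceAs (Epi (𝟙 M.right))) fun W x hx =>
        ⟨0, zero_comp.trans ((Category.comp_id x).symm.trans hx).symm⟩

instance injective_ofLeft (J : B) [Injective J] : Injective (ofLeft T J) where
  factors {M N} g f hf := by
    have := mono_left f
    exact ⟨toOfLeft (Injective.factorThru g.left f.left),
      ofLeft_hom_ext (Injective.comp_factorThru g.left f.left)⟩

instance injective_ofRight (I : A) [Injective I] : Injective (ofRight T I) where
  factors {M N} g f hf := by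
    have := mono_right f
    exact ⟨toOfRight (Injective.factorThru g.right f.right),
      ofRight_hom_ext (Injective.comp_factorThru g.right f.right)⟩

/-- `(0, -)` is an exact right adjoint of an exact functor, so it is compatible with `Ext¹`. -/
theorem extVanishes_ofLeft_iff [EnoughInjectives B] (M : CommaCat T) (Y : B) :
    ExtVanishes M (ofLeft T Y) ↔ ExtVanishes M.left Y := by
  have hS := shortExact_cokernel (Injective.ι Y)
  obtain ⟨w, hD⟩ := exists_shortExact_ofLeft (T := T) hS
  constructor
  · intro h
    refine extVanishes_of_exists_lift hS inferInstance fun f => ?_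
    obtain ⟨g, hg⟩ := h.exists_lift hD (toOfLeft f)
    exact ⟨g.left, congrArg CommaMorphism.left hg⟩
  · intro h
    refine extVanishes_of_exists_lift hD (injective_ofLeft _) fun f => ?_
    obtain ⟨g, hg⟩ := h.exists_lift hS f.left
    exact ⟨toOfLeft g, ofLeft_hom_ext hg⟩

/-- `a ↦ (a, T a)` is compatible with `Ext¹` at the objects at which `T` has no first derived
functor. -/
theorem extVanishes_ofRight_iff [EnoughInjectives A] {P : ObjectProperty A} (hT : IsExactOn T P)
    (M : CommaCat T) {X : A} (hX : P X) :
    ExtVanishes M (ofRight T X) ↔ ExtVanishes M.right X := by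
  have hS := shortExact_cokernel (Injective.ι X)
  obtain ⟨w, hD⟩ := exists_shortExact_ofRight hS (hT _ hS hX)
  constructor
  · intro h
    refine extVanishes_of_exists_lift hS inferInstance fun f => ?_
    obtain ⟨g, hg⟩ := h.exists_lift hD (toOfRight f)
    exact ⟨g.right, congrArg CommaMorphism.right hg⟩
  · intro h
    refine extVanishes_of_exists_lift hD (injective_ofRight _) fun f => ?_
    obtain ⟨g, hg⟩ := h.exists_lift hS f.right
    exact ⟨toOfRight g, ofRight_hom_ext hg⟩

/-- The structure maps of a short complex in the comma category, as a morphism of short complexes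
in `B`. -/
def structureMap (S : ShortComplex (CommaCat T)) :
    S.map (Comma.fst (𝟭 B) T) ⟶ (S.map (Comma.snd (𝟭 B) T)).map T where
  τ₁ := S.X₁.hom
  τ₂ := S.X₂.hom
  τ₃ := S.X₃.hom
  comm₁₂ := S.f.w.symm
  comm₂₃ := S.g.w.symm

/-- If the structure map of the first term is epi, the kernels of the structure maps form a short
exact sequence, even though `T` need not be right exact. -/
theorem exists_shortExact_kernel_hom {S : ShortComplex (CommaCat T)} (hS : S.ShortExact)
    (h₁ : Epi S.X₁.hom) :
    ∃ (f : kernel S.X₁.hom ⟶ kernel S.X₂.hom) (g : kernel S.X₂.hom ⟶ kernel S.X₃.hom)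
      (w : f ≫ g = 0),
      g ≫ kernel.ι S.X₃.hom = kernel.ι S.X₂.hom ≫ S.g.left ∧
      (ShortComplex.mk f g w).ShortExact := by
  have hr := shortExact_right hS
  have hm : Mono (T.map S.f.right) := by
    have := hr.mono_f
    exact inferInstanceAs (Mono (T.map (S.map (Comma.snd (𝟭 B) T)).f))
  have h := shortExact_kernels (structureMap S) (shortExact_left hS) (exact_map hr) hm h₁
  exact ⟨_, _, _, kernel.lift_ι _ _ _, h⟩

theorem epi_hom_of_shortExact {S : ShortComplex (CommaCat T)} (hS : S.ShortExact)
    (hT : Epi (T.map S.g.right)) (h₁ : Epi S.X₁.hom) (h₃ : Epi S.X₃.hom) : Epi S.X₂.hom := by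
  have : Epi ((S.map (Comma.snd (𝟭 B) T)).map T).g := hT
  have : Epi (S.map (Comma.fst (𝟭 B) T)).g := (shortExact_left hS).epi_g
  have : Epi (structureMap S).τ₁ := h₁
  have : Epi (structureMap S).τ₃ := h₃
  exact ShortComplex.epi_τ₂_of_exact_of_epi (structureMap S) (exact_map (shortExact_right hS))

end Comma

/-! ### Factoring a morphism through a special monomorphism -/

section Factorization

open ZeroObject

variable {C : Type u} [Category.{v} C] [Abelian C]

/-- The pushout of a short exact sequence along a morphism out of its first term is short exact. -/
theorem exists_shortExact_of_isPushout {S : ShortComplex C} (hS : S.ShortExact) {X' Y' : C}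
    {l : S.X₁ ⟶ X'} {r : S.X₂ ⟶ Y'} {b : X' ⟶ Y'} (h : IsPushout S.f l r b) :
    ∃ (q : Y' ⟶ S.X₃) (w : b ≫ q = 0), r ≫ q = S.g ∧ (ShortComplex.mk b q w).ShortExact := by
  have := hS.mono_f
  have := hS.epi_g
  have hr : r ≫ h.desc S.g 0 (by simp) = S.g := h.inl_desc _ _ _
  have hb : b ≫ h.desc S.g 0 (by simp) = 0 := h.inr_desc _ _ _
  refine ⟨_, hb, hr, ShortComplex.ShortExact.mk' ?_ ?_ ?_⟩
  · rw [ShortComplex.exact_iff_exact_up_to_refinements]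
    intro W x hx
    dsimp at x hx
    obtain ⟨W', π, _, y, z, hyz⟩ := h.hom_eq_add_up_to_refinements x
    have hy : y ≫ S.g = 0 := by
      have := congrArg (· ≫ h.desc S.g 0 (by simp)) hyz
      simpa [hx, hr, hb] using this.symm
    refine ⟨W', π, inferInstance, hS.exact.lift y hy ≫ l + z, ?_⟩
    dsimp
    rw [Preadditive.add_comp, Category.assoc, ← h.w, ← Category.assoc, hS.exact.lift_f, hyz]
  · exact MorphismProperty.of_isPushout (P := .monomorphisms C) h.flip ‹Mono S.f›
  · have : Epi (r ≫ h.desc S.g 0 (by simp)) := by rw [hr]; infer_instance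
    exact epi_of_epi r _

/-- If `P` is special preenveloping and there are enough projectives, every morphism `f : M ⟶ N`
factors as a monomorphism with cokernel in `⊥P` followed by an epimorphism with kernel in `P`. To
see this, make `f` epi by adding to `M` a projective object `Q` that maps onto `N`, and push out the
kernel sequence of `M ⊞ Q ⟶ N` along a special preenvelope of the kernel. -/
theorem exists_factorization [EnoughProjectives C] {P : ObjectProperty C}
    (hP : IsSpecialPreenveloping P) {M N : C} (f : M ⟶ N) :
    ∃ (E Y : C) (j : M ⟶ E) (k : Y ⟶ E) (q : E ⟶ N) (w : k ≫ q = 0), j ≫ q = f ∧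
      (ShortComplex.mk k q w).ShortExact ∧ P Y ∧ Mono j ∧ leftPerp P (cokernel j) := by
  let g : M ⊞ Projective.over N ⟶ N := biprod.desc f (Projective.π N)
  have hg : Epi g := by
    have : Epi (biprod.inr ≫ g) := by simp only [g, biprod.inr_desc]; infer_instance
    exact epi_of_epi biprod.inr g
  obtain ⟨Y, R, s, t, hst, hS, hY, hR⟩ := hP.exists_shortExact (kernel g)
  have h := IsPushout.of_hasPushout (kernel.ι g) s
  obtain ⟨q, w, hq, hE⟩ := exists_shortExact_of_isPushout (shortExact_kernel g) h
  obtain ⟨t', w', ht, hE'⟩ := exists_shortExact_of_isPushout hS h.flip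
  have hm : Mono (pushout.inl (kernel.ι g) s) := hE'.mono_f
  refine ⟨_, Y, biprod.inl ≫ pushout.inl _ _, pushout.inr _ _, q, w, ?_, hE, hY, inferInstance, ?_⟩
  · rw [Category.assoc, hq]
    exact biprod.inl_desc _ _
  · let S₀ : ShortComplex C := ShortComplex.mk (𝟙 M) (0 : M ⟶ 0) (by simp)
    have hS₀ : S₀.ShortExact := shortExact_of_exists_lift _ (inferInstanceAs (Mono (𝟙 M)))
      ⟨fun _ _ _ => (isZero_zero C).eq_of_src _ _⟩ fun W x _ => ⟨x, Category.comp_id x⟩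
    let φ : S₀ ⟶ ShortComplex.mk (pushout.inl (kernel.ι g) s) t' w' :=
      { τ₁ := biprod.inl
        τ₂ := biprod.inl ≫ pushout.inl _ _
        τ₃ := 0
        comm₁₂ := by simp [S₀]
        comm₂₃ := by simp [S₀, w'] }
    have hφ := shortExact_cokernels φ hS₀.exact hS₀.epi_g hE'
      ⟨fun _ _ _ => (isZero_zero C).eq_of_tgt _ _⟩
    intro Z hZ
    refine ExtVanishes.of_shortExact_left hφ ?_ ?_
    · exact ExtVanishes.of_iso_left extVanishes_of_projective
        (cokernelIsoOfShortExact (shortExact_biprod M (Projective.over N)))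
    · exact ExtVanishes.of_iso_left (hR Z hZ) cokernelZeroIsoTarget

end Factorization

/-! ### The extension closure of `h(X, Y)` -/

section HClass

variable {A : Type u₁} [Category.{v₁} A] [Abelian A] {B : Type u₂} [Category.{v₂} B] [Abelian B]
  {T : A ⥤ B} [T.Additive] [PreservesFiniteLimits T]
  {X : ObjectProperty A} {Y : ObjectProperty B}

omit [PreservesFiniteLimits T] in
theorem isZero_h_obj {a : A} {b : B} (ha : IsZero a) (hb : IsZero b) :
    IsZero ((h T).obj (a, b)) := by
  have hTa := T.map_isZero ha
  refine isZero_of_isZero_left_right ?_ ha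
  rw [IsZero.iff_id_eq_zero]
  exact biprod.hom_ext _ _ (hb.eq_of_tgt _ _) (hTa.eq_of_tgt _ _)

theorem containsZero_extensionClosure (hX : X.ContainsZero) (hY : Y.ContainsZero) :
    (extensionClosure (hClass T X Y)).ContainsZero := by
  obtain ⟨a, ha, hXa⟩ := hX.exists_zero
  obtain ⟨b, hb, hYb⟩ := hY.exists_zero
  exact ⟨_, isZero_h_obj ha hb, .of _ ⟨a, b, hXa, hYb, rfl⟩⟩

theorem extensionClosure_of_iso (hX : X.ContainsZero) (hY : Y.ContainsZero) {M N : CommaCat T}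
    (e : M ≅ N) (hM : extensionClosure (hClass T X Y) M) : extensionClosure (hClass T X Y) N :=
  prop_of_iso_of_closedUnderExtensions (containsZero_extensionClosure hX hY)
    (fun S hS h₁ h₃ => .ext S hS h₁ h₃) e hM

theorem extensionClosure_ofLeft (hX : X.ContainsZero) (hY : Y.ContainsZero) {b : B} (hb : Y b) :
    extensionClosure (hClass T X Y) (ofLeft T b) := by
  obtain ⟨a, ha, hXa⟩ := hX.exists_zero
  have hTa := T.map_isZero ha
  refine extensionClosure_of_iso hX hY ?_ (.of _ ⟨a, b, hXa, hb, rfl⟩)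
  let e : b ⊞ T.obj a ≅ b :=
    { hom := biprod.fst
      inv := biprod.inl
      hom_inv_id := biprod.hom_ext _ _ (by simp) (hTa.eq_of_tgt _ _) }
  exact Comma.isoMk e (ha.iso (isZero_zero A)) ((T.map_isZero (isZero_zero A)).eq_of_tgt _ _)

theorem extensionClosure_ofRight (hX : X.ContainsZero) (hY : Y.ContainsZero) {a : A} (ha : X a) :
    extensionClosure (hClass T X Y) (ofRight T a) := by
  obtain ⟨b, hb, hYb⟩ := hY.exists_zero
  refine extensionClosure_of_iso hX hY ?_ (.of _ ⟨a, b, ha, hYb, rfl⟩)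
  let e : b ⊞ T.obj a ≅ T.obj a :=
    { hom := biprod.snd
      inv := biprod.inr
      hom_inv_id := biprod.hom_ext _ _ (hb.eq_of_tgt _ _) (by simp) }
  refine Comma.isoMk e (Iso.refl a) ?_
  exact (congrArg (fun f => (biprod.snd : b ⊞ T.obj a ⟶ T.obj a) ≫ f) (T.map_id a)).symm

theorem extensionClosure_of_shortExact (hX : X.ContainsZero) (hY : Y.ContainsZero)
    {M : CommaCat T} {b : B} {k : b ⟶ M.left} {w : k ≫ M.hom = 0}
    (hM : (ShortComplex.mk k M.hom w).ShortExact) (hb : Y b) (hr : X M.right) :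
    extensionClosure (hClass T X Y) M := by
  obtain ⟨_, hS⟩ := exists_shortExact_of_hom M hM
  exact .ext _ hS (extensionClosure_ofLeft hX hY hb) (extensionClosure_ofRight hX hY hr)

/-- The objects of the extension closure of `h(X, Y)` have their component in `A` in `X` and an
epimorphic structure map with kernel in `Y`. -/
theorem hom_of_extensionClosure (hY : Y.ContainsZero)
    (hXe : X.IsClosedUnderExtensions) (hYe : Y.IsClosedUnderExtensions) (hT : IsExactOn T X)
    {M : CommaCat T} (hM : extensionClosure (hClass T X Y) M) :
    X M.right ∧ Epi M.hom ∧ Y (kernel M.hom) := by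
  induction hM with
  | of M hM =>
    obtain ⟨a, b, ha, hb, rfl⟩ := hM
    refine ⟨ha, inferInstanceAs (Epi (biprod.snd : b ⊞ T.obj a ⟶ T.obj a)), ?_⟩
    exact prop_of_iso_of_closedUnderExtensions hY (fun S hS => Y.prop_X₂_of_shortExact hS)
      (kernelIsoOfShortExact (shortExact_biprod b (T.obj a))).symm hb
  | ext S hS _ _ h₁ h₃ =>
    obtain ⟨hr₁, he₁, hk₁⟩ := h₁
    obtain ⟨hr₃, he₃, hk₃⟩ := h₃
    have hr := shortExact_right hS
    obtain ⟨f, g, w, -, hk⟩ := exists_shortExact_kernel_hom hS he₁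
    exact ⟨X.prop_X₂_of_shortExact hr hr₁ hr₃,
      epi_hom_of_shortExact hS (hT _ hr hr₁).epi_g he₁ he₃, Y.prop_X₂_of_shortExact hk hk₁ hk₃⟩

/-- `⊥⟨h(X, Y)⟩` consists of the objects with components in `⊥X` and `⊥Y`. -/
theorem leftPerp_extensionClosure_hClass_iff [EnoughInjectives A] [EnoughInjectives B]
    (hX : X.ContainsZero) (hY : Y.ContainsZero) (hT : IsExactOn T X) (M : CommaCat T) :
    leftPerp (extensionClosure (hClass T X Y)) M ↔ leftPerp X M.right ∧ leftPerp Y M.left := by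
  constructor
  · exact fun h => ⟨fun a ha => (extVanishes_ofRight_iff hT M ha).1
      (h _ (extensionClosure_ofRight hX hY ha)),
      fun b hb => (extVanishes_ofLeft_iff M b).1 (h _ (extensionClosure_ofLeft hX hY hb))⟩
  · rintro ⟨hr, hl⟩
    refine leftPerp_extensionClosure ?_
    rintro _ ⟨a, b, ha, hb, rfl⟩
    obtain ⟨_, hS⟩ := exists_shortExact_of_hom ((h T).obj (a, b)) (shortExact_biprod b (T.obj a))
    exact ExtVanishes.of_shortExact_right hS ((extVanishes_ofLeft_iff M b).2 (hl b hb))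
      ((extVanishes_ofRight_iff hT M ha).2 (hr a ha))

end HClass

/-! ### Special preenvelopes in the comma category -/

section Preenvelope

variable {A : Type u₁} [Category.{v₁} A] [Abelian A] {B : Type u₂} [Category.{v₂} B] [Abelian B]
  {T : A ⥤ B} [T.Additive] [PreservesFiniteLimits T] [EnoughInjectives A] [EnoughInjectives B]
  {X : ObjectProperty A} {Y : ObjectProperty B}

/-- To build a preenvelope of `M`, embed `M.right` into `a` in `X`, and factor the composite
`M.left ⟶ T M.right ⟶ T a` through a special monomorphism. -/
theorem isSpecialPreenveloping_extensionClosure [EnoughProjectives B]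
    (hX : X.ContainsZero) (hY : Y.ContainsZero) (hT : IsExactOn T X)
    (hXs : IsSpecialPreenveloping X) (hYs : IsSpecialPreenveloping Y) :
    IsSpecialPreenveloping (extensionClosure (hClass T X Y)) := by
  intro M
  obtain ⟨a, i, hi⟩ := hXs M.right
  obtain ⟨E, b, j, k, q, w, hjq, hE, hb, hj, hperp⟩ := exists_factorization hYs (M.hom ≫ T.map i)
  let L : CommaCat T := { left := E, right := a, hom := q }
  let g : M ⟶ L := { left := j, right := i, w := hjq }
  have := hi.mono
  have hg : Mono g := mono_of_mono_left_right g hj hi.mono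
  refine ⟨L, g, hg, extensionClosure_of_shortExact hX hY (M := L) hE hb hi.mem, ?_⟩
  rw [leftPerp_extensionClosure_hClass_iff hX hY hT]
  have hS := shortExact_cokernel g
  exact ⟨leftPerp_of_iso hi.cokernel_mem (cokernelIsoOfShortExact (shortExact_right hS)).symm,
    leftPerp_of_iso hperp (cokernelIsoOfShortExact (shortExact_left hS)).symm⟩

theorem isSpecialPreenveloping_right_of_extensionClosure
    (hX : X.ContainsZero) (hY : Y.ContainsZero) (hT : IsExactOn T X)
    (hXe : X.IsClosedUnderExtensions) (hYe : Y.IsClosedUnderExtensions)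
    (hs : IsSpecialPreenveloping (extensionClosure (hClass T X Y))) :
    IsSpecialPreenveloping X := by
  intro a
  obtain ⟨L, g, hg⟩ := hs (ofRight T a)
  have := hg.mono
  exact ⟨_, _, isSpecialPreenvelope_of_shortExact (shortExact_right (shortExact_cokernel g))
    (hom_of_extensionClosure hY hXe hYe hT hg.mem).1
    ((leftPerp_extensionClosure_hClass_iff hX hY hT _).1 hg.cokernel_mem).1⟩

/-- If `L` is a special preenvelope of `(0, b)`, then the kernel of the structure map of `L` is a
special preenvelope of `b`: as `L.right` lies in `X ∩ ⊥X`, the structure map of `L` splits, so that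
the kernel modulo `b` is a direct summand of `L.left` modulo `b`. -/
theorem isSpecialPreenveloping_left_of_extensionClosure
    (hX : X.ContainsZero) (hY : Y.ContainsZero) (hT : IsExactOn T X)
    (hXY : ∀ a : A, leftPerp X a → X a → leftPerp Y (T.obj a))
    (hXe : X.IsClosedUnderExtensions) (hYe : Y.IsClosedUnderExtensions)
    (hs : IsSpecialPreenveloping (extensionClosure (hClass T X Y))) :
    IsSpecialPreenveloping Y := by
  intro b
  obtain ⟨L, g, hg⟩ := hs (ofLeft T b)
  have := hg.mono
  have hS := shortExact_cokernel g
  obtain ⟨hr, he, hk⟩ := hom_of_extensionClosure hY hXe hYe hT hg.mem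
  obtain ⟨hpr, hpl⟩ := (leftPerp_extensionClosure_hClass_iff hX hY hT _).1 hg.cokernel_mem
  have hz : Epi (ofLeft T b).hom :=
    ⟨fun _ _ _ => (T.map_isZero (isZero_zero A)).eq_of_src _ _⟩
  obtain ⟨f, p, w, hp, hK⟩ := exists_shortExact_kernel_hom hS hz
  -- `L.right` is isomorphic to the component in `A` of the cokernel, since `(0, b).right = 0`.
  have hiso : IsIso (cokernel.π g).right :=
    (shortExact_right hS).isIso_g_iff.2 (isZero_zero A)
  have hLr : leftPerp X L.right := leftPerp_of_iso hpr (asIso (cokernel.π g).right)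
  obtain ⟨s, hsec⟩ := ExtVanishes.exists_lift (shortExact_kernel L.hom) (hXY _ hLr hr _ hk) (𝟙 _)
  dsimp at s hsec
  let N := cokernel g
  -- the resulting section of the structure map of the cokernel
  let s' : T.obj N.right ⟶ N.left := T.map (inv (cokernel.π g).right) ≫ s ≫ (cokernel.π g).left
  have hs' : s' ≫ N.hom = 𝟙 _ := by
    have hw : (cokernel.π g).left ≫ N.hom = L.hom ≫ T.map (cokernel.π g).right :=
      (cokernel.π g).w
    simp only [s', Category.assoc, hw, reassoc_of% hsec]
    rw [← T.map_comp, IsIso.inv_hom_id, T.map_id]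
  have hret : leftPerp Y (kernel N.hom) := leftPerp_kernel_of_section hpl N.hom s' hs'
  exact ⟨_, _, isSpecialPreenvelope_of_shortExact
    (shortExact_of_iso_left hK (kernelZeroIsoSource (X := b)).symm) hk hret⟩

end Preenvelope

/-! ### Gorenstein injective objects of the comma category -/

section CommaGorenstein

open ZeroObject

variable {A : Type u₁} [Category.{v₁} A] [Abelian A] {B : Type u₂} [Category.{v₂} B] [Abelian B]
  {T : A ⥤ B} [T.Additive] [PreservesFiniteLimits T]

omit [Abelian A] [T.Additive] [PreservesFiniteLimits T] in
theorem injective_right {E : CommaCat T} (hE : Injective E) : Injective E.right where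
  factors {X Y} g f hf := by
    let X' : CommaCat T := { left := 0, right := X, hom := 0 }
    let Y' : CommaCat T := { left := 0, right := Y, hom := 0 }
    let f' : X' ⟶ Y' := { left := 0, right := f, w := by simp [X', Y'] }
    let g' : X' ⟶ E :=
      { left := 0, right := g, w := (isZero_zero B).eq_of_src (Y := T.obj E.right) _ _ }
    have : Mono f' :=
      mono_of_mono_left_right f' ⟨fun _ _ _ => (isZero_zero B).eq_of_tgt _ _⟩ hf
    exact ⟨(Injective.factorThru g' f').right,
      congrArg CommaMorphism.right (Injective.comp_factorThru g' f')⟩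

omit [PreservesFiniteLimits T] in
theorem injective_kernel_hom {E : CommaCat T} (hE : Injective E) : Injective (kernel E.hom) where
  factors {X Y} g f hf := by
    let f' : ofLeft T X ⟶ ofLeft T Y := toOfLeft f
    let g' : ofLeft T X ⟶ E := ofLeftTo (g ≫ kernel.ι E.hom) (by simp)
    have : Mono f' :=
      mono_of_mono_left_right f' hf ⟨fun _ _ _ => (isZero_zero A).eq_of_tgt _ _⟩
    let k := Injective.factorThru g' f'
    have hk : k.left ≫ E.hom = 0 := k.w.trans zero_comp
    refine ⟨kernel.lift E.hom k.left hk, ?_⟩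
    rw [← cancel_mono (kernel.ι E.hom), Category.assoc, kernel.lift_ι]
    exact congrArg CommaMorphism.left (Injective.comp_factorThru g' f')

omit [Abelian A] [T.Additive] [PreservesFiniteLimits T] in
/-- The structure map of an injective object `E` splits: `E` is a direct summand of
`h(E.right, E.left)`, by a projection which is the identity on the component in `A`. -/
theorem exists_section_of_injective {E : CommaCat T} (hE : Injective E) :
    ∃ s : T.obj E.right ⟶ E.left, s ≫ E.hom = 𝟙 _ := by
  -- `u` is the unit of the adjunction between the forgetful functor and `h`.
  let u : E ⟶ (h T).obj (E.right, E.left) :=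
    { left := biprod.lift (𝟙 E.left) E.hom
      right := 𝟙 E.right
      w := by
        have e : biprod.lift (𝟙 E.left) E.hom ≫ biprod.snd = E.hom := biprod.lift_snd _ _
        exact e.trans ((congrArg (fun f => E.hom ≫ f) (T.map_id E.right)).trans
          (Category.comp_id _)).symm }
  have hu : Mono (biprod.lift (𝟙 E.left) E.hom) := by
    have : Mono (biprod.lift (𝟙 E.left) E.hom ≫ biprod.fst) := by
      rw [biprod.lift_fst]; infer_instance
    exact mono_of_mono _ biprod.fst
  have : Mono u := mono_of_mono_left_right u hu (inferInstanceAs (Mono (𝟙 E.right)))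
  let r := Injective.factorThru (𝟙 E) u
  have hr : r.right = 𝟙 E.right := by
    have := congrArg CommaMorphism.right (Injective.comp_factorThru (𝟙 E) u)
    exact (Category.id_comp _).symm.trans this
  let l : E.left ⊞ T.obj E.right ⟶ E.left := r.left
  have hl : l ≫ E.hom = biprod.snd :=
    (r.w : l ≫ E.hom = biprod.snd ≫ T.map r.right).trans (by
      rw [hr]
      exact (congrArg (fun f => (biprod.snd : E.left ⊞ T.obj E.right ⟶ _) ≫ f)
        (T.map_id E.right)).trans (Category.comp_id _))
  exact ⟨biprod.inr ≫ l, by rw [Category.assoc, hl, biprod.inr_snd]⟩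

omit [Abelian A] [T.Additive] [PreservesFiniteLimits T] in
theorem epi_hom_of_injective {E : CommaCat T} (hE : Injective E) : Epi E.hom := by
  obtain ⟨s, hs⟩ := exists_section_of_injective hE
  have : Epi (s ≫ E.hom) := by rw [hs]; infer_instance
  exact epi_of_epi s _

variable (T) in
/-- Injective objects of the comma category have injective components in `A`, so that the components
in `A` of its Gorenstein injective objects are cycles of acyclic complexes of injectives. -/
theorem isInjResolving_right :
    IsInjResolving (fun a : A => ∃ M : CommaCat T, gorensteinInjective _ M ∧ M.right = a) where
  exists_right := by
    rintro _ ⟨M, hM, rfl⟩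
    obtain ⟨N, hN, I, i, p, w, hS, hI⟩ :=
      (isGorensteinResolving_gorensteinInjective _).exists_right M hM
    exact ⟨N.right, ⟨N, hN, rfl⟩, _, _, _, _, shortExact_right hS, injective_right hI⟩
  exists_left := by
    rintro _ ⟨M, hM, rfl⟩
    obtain ⟨N, hN, I, i, p, w, hS, hI⟩ :=
      (isGorensteinResolving_gorensteinInjective _).exists_left M hM
    exact ⟨N.right, ⟨N, hN, rfl⟩, _, _, _, _, shortExact_right hS, injective_right hI⟩

namespace IsCocompatible

variable (hT : IsCocompatible T)

include hT

theorem epi_hom {M : CommaCat T} (hM : gorensteinInjective _ M) : Epi M.hom := by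
  obtain ⟨N, hN, I, i, p, w, hS, hI⟩ :=
    (isGorensteinResolving_gorensteinInjective _).exists_left M hM
  have h₁ : Epi (T.map p.right) :=
    (hT.isExactOn (isInjResolving_right T) _ (shortExact_right hS) ⟨N, hN, rfl⟩).epi_g
  have h₂ := epi_hom_of_injective hI
  have h₃ : Epi (p.left ≫ M.hom) := by
    have e : p.left ≫ M.hom = I.hom ≫ T.map p.right := p.w
    rw [e]
    exact epi_comp' h₂ h₁
  exact epi_of_epi p.left M.hom

/-- The `Ext¹`-condition for the kernels follows from that in the comma category, since `(0, J)` is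
injective for every injective object `J` of `B`. -/
theorem isGorensteinResolving_kernel : IsGorensteinResolving
    (fun b : B => ∃ M : CommaCat T, gorensteinInjective _ M ∧ kernel M.hom = b) where
  exists_right := by
    rintro _ ⟨M, hM, rfl⟩
    obtain ⟨N, hN, I, i, p, w, hS, hI⟩ :=
      (isGorensteinResolving_gorensteinInjective _).exists_right M hM
    obtain ⟨f, g, w', -, hK⟩ := exists_shortExact_kernel_hom hS (hT.epi_hom hM)
    exact ⟨_, ⟨N, hN, rfl⟩, _, f, g, w', hK, injective_kernel_hom hI⟩
  exists_left := by
    rintro _ ⟨M, hM, rfl⟩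
    obtain ⟨N, hN, I, i, p, w, hS, hI⟩ :=
      (isGorensteinResolving_gorensteinInjective _).exists_left M hM
    obtain ⟨f, g, w', -, hK⟩ := exists_shortExact_kernel_hom hS (hT.epi_hom hN)
    exact ⟨_, ⟨N, hN, rfl⟩, _, f, g, w', hK, injective_kernel_hom hI⟩
  extVanishes := by
    rintro _ ⟨M, hM, rfl⟩ J hJ
    have hG := isGorensteinResolving_gorensteinInjective (CommaCat T)
    obtain ⟨N, hN, I, i, p, w, hS, hI⟩ := hG.exists_right M hM
    obtain ⟨f, g, w', hg, hK⟩ := exists_shortExact_kernel_hom hS (hT.epi_hom hM)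
    refine extVanishes_of_exists_lift hK (injective_kernel_hom hI) fun (x : J ⟶ kernel N.hom) => ?_
    obtain ⟨y, hy⟩ := (hG.extVanishes M hM (ofLeft T J) inferInstance).exists_lift hS
      (ofLeftTo (x ≫ kernel.ι N.hom) (by simp))
    have hy₀ : y.left ≫ I.hom = 0 := y.w.trans zero_comp
    have hyl : y.left ≫ p.left = x ≫ kernel.ι N.hom := congrArg CommaMorphism.left hy
    refine ⟨kernel.lift I.hom y.left hy₀, ?_⟩
    rw [← cancel_mono (kernel.ι N.hom), Category.assoc]
    dsimp at hg ⊢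
    rw [hg, kernel.lift_ι_assoc, hyl]

theorem gorensteinInjective_kernel {M : CommaCat T} (hM : gorensteinInjective _ M) :
    gorensteinInjective B (kernel M.hom) :=
  hT.isGorensteinResolving_kernel.le_gorensteinInjective _ ⟨M, hM, rfl⟩

theorem gorensteinInjective_right {M : CommaCat T} (hM : gorensteinInjective _ M) :
    gorensteinInjective A M.right := by
  refine IsGorensteinResolving.le_gorensteinInjective
    (G := fun a : A => ∃ M : CommaCat T, gorensteinInjective _ M ∧ M.right = a)
    { toIsInjResolving := isInjResolving_right T, extVanishes := ?_ } _ ⟨M, hM, rfl⟩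
  rintro _ ⟨M, hM, rfl⟩ E hE
  have hG := isGorensteinResolving_gorensteinInjective (CommaCat T)
  obtain ⟨N, hN, I, i, p, w, hS, hI⟩ := hG.exists_right M hM
  refine extVanishes_of_exists_lift (shortExact_right hS) (injective_right hI)
    fun (x : E ⟶ N.right) => ?_
  -- `x` extends to a morphism `(E, T E) ⟶ N` because `Ext¹(T E, ker N.hom) = 0`.
  have := hT.epi_hom hN
  obtain ⟨y, hy⟩ := (hT.extVanishes hE (hT.gorensteinInjective_kernel hN)).exists_lift
    (shortExact_kernel N.hom) (T.map x)
  obtain ⟨z, hz⟩ := (hG.extVanishes M hM (ofRight T E) inferInstance).exists_lift hS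
    ({ left := y, right := x, w := hy.trans (Category.id_comp _).symm } : ofRight T E ⟶ N)
  exact ⟨z.right, congrArg CommaMorphism.right hz⟩

theorem isExactOn_gorensteinInjective : IsExactOn T (gorensteinInjective A) :=
  hT.isExactOn (isGorensteinResolving_gorensteinInjective A).toIsInjResolving

theorem gorensteinInjective_ofRight [EnoughInjectives A] {a : A} (ha : gorensteinInjective A a) :
    gorensteinInjective _ (ofRight T a) := by
  have hG := isGorensteinResolving_gorensteinInjective A
  have hE := hT.isExactOn_gorensteinInjective
  refine IsGorensteinResolving.le_gorensteinInjective
    (G := fun M : CommaCat T => ∃ a : A, gorensteinInjective A a ∧ ofRight T a = M)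
    { exists_right := ?_, exists_left := ?_, extVanishes := ?_ } _ ⟨a, ha, rfl⟩
  · rintro _ ⟨a, ha, rfl⟩
    obtain ⟨N, hN, I, i, p, w, hS, hI⟩ := hG.exists_right a ha
    obtain ⟨w', hD⟩ := exists_shortExact_ofRight hS (hE _ hS ha)
    exact ⟨_, ⟨N, hN, rfl⟩, _, _, _, w', hD, injective_ofRight I⟩
  · rintro _ ⟨a, ha, rfl⟩
    obtain ⟨N, hN, I, i, p, w, hS, hI⟩ := hG.exists_left a ha
    obtain ⟨w', hD⟩ := exists_shortExact_ofRight hS (hE _ hS hN)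
    exact ⟨_, ⟨N, hN, rfl⟩, _, _, _, w', hD, injective_ofRight I⟩
  · rintro _ ⟨a, ha, rfl⟩ E hE'
    exact (extVanishes_ofRight_iff hE E ha).2 (hG.extVanishes a ha _ (injective_right hE'))

theorem gorensteinInjective_ofLeft [EnoughInjectives B] {b : B} (hb : gorensteinInjective B b) :
    gorensteinInjective _ (ofLeft T b) := by
  have hG := isGorensteinResolving_gorensteinInjective B
  refine IsGorensteinResolving.le_gorensteinInjective
    (G := fun M : CommaCat T => ∃ b : B, gorensteinInjective B b ∧ ofLeft T b = M)
    { exists_right := ?_, exists_left := ?_, extVanishes := ?_ } _ ⟨b, hb, rfl⟩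
  · rintro _ ⟨b, hb, rfl⟩
    obtain ⟨N, hN, I, i, p, w, hS, hI⟩ := hG.exists_right b hb
    obtain ⟨w', hD⟩ := exists_shortExact_ofLeft (T := T) hS
    exact ⟨_, ⟨N, hN, rfl⟩, _, _, _, w', hD, injective_ofLeft I⟩
  · rintro _ ⟨b, hb, rfl⟩
    obtain ⟨N, hN, I, i, p, w, hS, hI⟩ := hG.exists_left b hb
    obtain ⟨w', hD⟩ := exists_shortExact_ofLeft (T := T) hS
    exact ⟨_, ⟨N, hN, rfl⟩, _, _, _, w', hD, injective_ofLeft I⟩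
  · rintro _ ⟨b, hb, rfl⟩ E hE
    have := epi_hom_of_injective hE
    exact (extVanishes_ofLeft_iff E b).2 (ExtVanishes.of_shortExact_left (shortExact_kernel E.hom)
      (hG.extVanishes b hb _ (injective_kernel_hom hE)) (hT.extVanishes (injective_right hE) hb))

/-- The Gorenstein injective objects of the comma category are the extensions of `(a, T a)` by
`(0, b)` with `a` and `b` Gorenstein injective. -/
theorem gorensteinInjective_iff [EnoughInjectives A] [EnoughInjectives B] (M : CommaCat T) :
    gorensteinInjective _ M ↔
      gorensteinInjective A M.right ∧ Epi M.hom ∧ gorensteinInjective B (kernel M.hom) := by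
  refine ⟨fun hM => ⟨hT.gorensteinInjective_right hM, hT.epi_hom hM,
    hT.gorensteinInjective_kernel hM⟩, fun ⟨hr, he, hk⟩ => ?_⟩
  obtain ⟨w, hS⟩ := exists_shortExact_of_hom M (shortExact_kernel M.hom)
  exact gorensteinInjective_of_shortExact hS (hT.gorensteinInjective_ofLeft hk)
    (hT.gorensteinInjective_ofRight hr)

theorem extensionClosure_gorensteinInjective [EnoughInjectives A] [EnoughInjectives B] :
    extensionClosure (hClass T (gorensteinInjective A) (gorensteinInjective B)) =
      gorensteinInjective (CommaCat T) := by
  ext M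
  rw [hT.gorensteinInjective_iff]
  constructor
  · exact hom_of_extensionClosure (gorensteinInjective_containsZero B)
      inferInstance inferInstance hT.isExactOn_gorensteinInjective
  · rintro ⟨hr, he, hk⟩
    exact extensionClosure_of_shortExact (gorensteinInjective_containsZero A)
      (gorensteinInjective_containsZero B) (shortExact_kernel M.hom) hk hr

end IsCocompatible

end CommaGorenstein

end CommaPreenvelope

end

theorem mainTheorem3
    {A : Type u₁} [Category.{v₁} A] [Abelian A] [EnoughProjectives A] [EnoughInjectives A]
    {B : Type u₂} [Category.{v₂} B] [Abelian B] [EnoughProjectives B] [EnoughInjectives B]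
    (T : A ⥤ B) [T.Additive] [PreservesFiniteLimits T] :
    (∀ (X : ObjectProperty A) (Y : ObjectProperty B), X.ContainsZero → Y.ContainsZero →
      CommaPreenvelope.IsExactOn T X →
      ((CommaPreenvelope.IsSpecialPreenveloping X ∧ CommaPreenvelope.IsSpecialPreenveloping Y →
          CommaPreenvelope.IsSpecialPreenveloping
            (CommaPreenvelope.extensionClosure (CommaPreenvelope.hClass T X Y))) ∧
        ((∀ a : A, CommaPreenvelope.leftPerp X a → X a →
            CommaPreenvelope.leftPerp Y (T.obj a)) →
          X.IsClosedUnderExtensions → Y.IsClosedUnderExtensions →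
          CommaPreenvelope.IsSpecialPreenveloping
            (CommaPreenvelope.extensionClosure (CommaPreenvelope.hClass T X Y)) →
          CommaPreenvelope.IsSpecialPreenveloping X ∧
            CommaPreenvelope.IsSpecialPreenveloping Y))) ∧
    (CommaPreenvelope.IsCocompatible T →
      (CommaPreenvelope.IsSpecialPreenveloping (CommaPreenvelope.gorensteinInjective A) ∧
          CommaPreenvelope.IsSpecialPreenveloping (CommaPreenvelope.gorensteinInjective B) ↔
        CommaPreenvelope.IsSpecialPreenveloping
          (CommaPreenvelope.gorensteinInjective (CommaPreenvelope.CommaCat T)))) := by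
  refine ⟨fun X Y hX hY hT => ⟨fun ⟨hXs, hYs⟩ =>
    CommaPreenvelope.isSpecialPreenveloping_extensionClosure hX hY hT hXs hYs,
    fun hXY hXe hYe hs =>
      ⟨CommaPreenvelope.isSpecialPreenveloping_right_of_extensionClosure hX hY hT hXe hYe hs,
        CommaPreenvelope.isSpecialPreenveloping_left_of_extensionClosure hX hY hT hXY hXe hYe hs⟩⟩,
    fun hT => ?_⟩
  have hA := CommaPreenvelope.gorensteinInjective_containsZero A
  have hB := CommaPreenvelope.gorensteinInjective_containsZero B
  have hE := hT.isExactOn_gorensteinInjective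
  rw [← hT.extensionClosure_gorensteinInjective]
  refine ⟨fun ⟨hXs, hYs⟩ =>
    CommaPreenvelope.isSpecialPreenveloping_extensionClosure hA hB hE hXs hYs, fun hs =>
    ⟨CommaPreenvelope.isSpecialPreenveloping_right_of_extensionClosure hA hB hE
      inferInstance inferInstance hs,
    CommaPreenvelope.isSpecialPreenveloping_left_of_extensionClosure hA hB hE (fun a ha hG => ?_)
      inferInstance inferInstance hs⟩⟩
  have ha' := CommaPreenvelope.injective_of_gorensteinInjective_of_leftPerp hG ha
  exact fun b hb => hT.extVanishes ha' hb
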